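/- Let $V$ be a finite set and $\mathcal L=\{x\in[0,\infty)^V:\max_i x_i>1\}$. A multivariate Pareto distribution is a random vector $Y=(Y_i)_{i\in V}$ with values in $\mathcal L$ that satisfies $\mathbb P(Y\in tA)=t^{-1}\mathbb P(Y\in A)$ for all $t\ge 1$ and all Borel $A\subset\mathcal L$, and has normalized margins, i.e. $\mathbb P(Y_i>1)$ is the same for all $i\in V$. For $m\in V$ let $Y^m$ denote $Y$ conditioned on $\{Y_m>1\}$, and let $\mathcal L^m=\{x\in\mathcal L:x_m>1\}$. A random variable $P$ is standard Pareto if $\mathbb P(P\le x)=1-1/x$ for $x\ge1$. The extremal function of $Y$ relative to $m$ is the (unique in law) random vector $W^m=(W^m_i)_{i\in V}$ with non-negative entries and $W^m_m=1$ almost surely, such that $Y^m\overset{d}{=}P\,W^m$ with $P$ standard Pareto and independent of $W^m$. The vector $Y$ is an extremal graphical model on a graph $G=(V,E)$ if for all pairwise disjoint $A,B,C\subset V$ such that every path in $G$ from $A$ to $C$ contains a node of $B$, and for every $m\in V$, the vectors $Y^m_A$ and $Y^m_C$ are conditionally independent given $Y^m_B$. Let $T=(V,E)$ be a tree. For $m\in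 V$ let $E^m$ be the set of directed edges obtained by orienting all edges of $T$ away from $m$, and for $i\in V$ let $\mathrm{ph}(mi)\subset E^m$ be the set of directed edges on the unique path from $m$ to $i$ (empty if $i=m$; empty products are $1$). **(a)** Let $Y$ be a multivariate Pareto distribution that is an extremal graphical model on $T$. Then for every $i\in V$ the extremal function $W^i$ of $Y$ relative to $i$ exists and is unique in law. Moreover, for every $m\in V$, if $\{W_e:e\in E^m\}$ are independent random variables such that, for each $e=(i,j)\in E^m$, $W_e$ has the law of $W^i_j$, and if $P$ is standard Pareto and independent of $\{W_e:e\in E^m\}$, then $$(Y^m_i)_{i\in V}\overset{d}{=}\Big(P\prod_{e\in\mathrm{ph}(mi)}W_e\Big)_{i\in V}.$$ **(b)** Conversely, let $\{W_{(i,j)},W_{(j,i)}:\{i,j\}\in E\}$ be independent, almost surely non-negative random variables such that for every $\{i,j\}\in E$, in both orders, $$\mathbb P(W_{(j,i)}\le z,\ W_{(j,i)}>0)=\mathbb E\big(\mathbf 1\{1/W_{(i,j)}\le z\}\,W_{(i,j)}\big),\qquad z>0.$$ For $m\in V$ put $W^m=\big(\prod_{e\in\mathrm{ph}(mi)}W_e\big)_{i\in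 V}$ and let $P$ be standard Pareto and independent of these variables. Then the vectors $P\,W^m$ are consistent: for all $m,m'\in V$ and all Borel $A\subset\mathcal L^m\cap\mathcal L^{m'}$, $\mathbb P(P\,W^m\in A)=\mathbb P(P\,W^{m'}\in A)$. Furthermore there is exactly one (in law) multivariate Pareto distribution $Y$ on $V$ whose extremal function relative to $m$ is $W^m$ for every $m\in V$, and this $Y$ is an extremal graphical model on $T$. -/

import Mathlib

open MeasureTheory ProbabilityTheory
open scoped ENNReal

noncomputable section

namespace ExtremalTree

/-! ### Multivariate Pareto distributions -/

/-- The set `𝓛 = {x ≥ 0 : ‖x‖_∞ > 1}` on which multivariate Pareto distributions live. -/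
def paretoSupport (V : Type*) : Set (V → ℝ) :=
  {x | (∀ i, 0 ≤ x i) ∧ ∃ i, 1 < x i}

/-- The set `𝓛ᵐ = {x ∈ 𝓛 : x_m > 1}`. -/
def paretoSupportAt {V : Type*} (m : V) : Set (V → ℝ) :=
  {x | x ∈ paretoSupport V ∧ 1 < x m}

/-- `μ` is (the law of) a multivariate Pareto distribution with index set `V`, on the normalized
marginal scale: a probability measure concentrated on `𝓛`, homogeneous of order `-1`, whose
margins all have the same probability of exceeding the threshold `1` (this probability is
`1 / ℓ(1, …, 1)` in terms of the stable tail dependence function `ℓ`). -/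
structure IsMultivariatePareto {V : Type*} (μ : Measure (V → ℝ)) : Prop where
  isProbabilityMeasure : IsProbabilityMeasure μ
  ae_mem_support : ∀ᵐ x ∂μ, x ∈ paretoSupport V
  homogeneous : ∀ t : ℝ, 1 ≤ t → ∀ A : Set (V → ℝ), MeasurableSet A → A ⊆ paretoSupport V →
    μ ((fun x => t • x) '' A) = (ENNReal.ofReal t)⁻¹ * μ A
  margins : ∀ i j : V, μ {x | 1 < x i} = μ {x | 1 < x j}

/-- The law of `Yᵐ`, that is, of `Y` conditioned on `{Y_m > 1}`, where `Y` has law `μ`. -/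
def exceedanceLaw {V : Type*} (μ : Measure (V → ℝ)) (m : V) : Measure (V → ℝ) :=
  cond μ {x | 1 < x m}

/-- The standard Pareto distribution, `ℙ(P ≤ x) = 1 - 1 / x` for `x ≥ 1`. -/
def stdPareto : Measure ℝ := paretoMeasure 1 1

/-- The law of `P • W`, where `P` is standard Pareto, `W` has law `ν`, and `P`, `W` are
independent. -/
def paretoMixture {V : Type*} (ν : Measure (V → ℝ)) : Measure (V → ℝ) :=
  (stdPareto.prod ν).map (fun q => q.1 • q.2)

/-- `ν` is the law of the extremal function `Wᵐ` of `Y ∼ μ` relative to coordinate `m`: a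
non-negative random vector with `Wᵐ_m = 1` almost surely and `Yᵐ = P Wᵐ` in distribution, with
`P` standard Pareto and independent of `Wᵐ`. -/
structure IsExtremalFunction {V : Type*} (μ : Measure (V → ℝ)) (m : V)
    (ν : Measure (V → ℝ)) : Prop where
  isProbabilityMeasure : IsProbabilityMeasure ν
  ae_nonneg : ∀ᵐ w ∂ν, ∀ i, 0 ≤ w i
  ae_eq_one : ∀ᵐ w ∂ν, w m = 1
  exceedanceLaw_eq : exceedanceLaw μ m = paretoMixture ν

/-! ### Extremal conditional independence and extremal graphical models -/

instance {V : Type*} (μ : Measure (V → ℝ)) (m : V) : IsFiniteMeasure (exceedanceLaw μ m) := by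
  unfold exceedanceLaw
  infer_instance

/-- Extremal conditional independence `Y_A ⊥ₑ Y_C | Y_B` for `Y ∼ μ`: for every `m`, the
subvectors `Yᵐ_A` and `Yᵐ_C` are conditionally independent given `Yᵐ_B`. -/
def ExtremalCondIndep {V : Type*} [Fintype V] (μ : Measure (V → ℝ)) (A B C : Set V) : Prop :=
  ∀ m : V, CondIndepFun
    (MeasurableSpace.comap (fun (y : V → ℝ) (b : B) => y b) inferInstance)
    (Measurable.comap_le (by fun_prop))
    (fun (y : V → ℝ) (a : A) => y a) (fun (y : V → ℝ) (c : C) => y c) (exceedanceLaw μ m)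

/-- `B` separates `A` from `C` in `G`: every path from `A` to `C` meets `B`. -/
def Separates {V : Type*} (G : SimpleGraph V) (A B C : Set V) : Prop :=
  ∀ a ∈ A, ∀ c ∈ C, ∀ p : G.Walk a c, p.IsPath → ∃ b ∈ B, b ∈ p.support

/-- The extremal global Markov property of `Y ∼ μ` on `G`. -/
def IsExtremalGraphicalModel {V : Type*} [Fintype V] (G : SimpleGraph V)
    (μ : Measure (V → ℝ)) : Prop :=
  ∀ A B C : Set V, Disjoint A B → Disjoint B C → Disjoint A C →
    Separates G A B C → ExtremalCondIndep μ A B C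

/-! ### Trees -/

/-- The edge set `Eᵐ` of the directed tree `Tᵐ`: the orientations of the edges of `T` that point
away from the root `m`. -/
def outwardEdges {V : Type*} (T : SimpleGraph V) (m : V) : Set T.Dart :=
  {e | T.dist m e.snd = T.dist m e.fst + 1}

/-- The unique path from `v` to `w` in the tree `T`. -/
def treePath {V : Type*} {T : SimpleGraph V} (hT : T.IsTree) (v w : V) : T.Walk v w :=
  (hT.existsUnique_path v w).choose

/-- The vector with entries `∏_{e ∈ ph(mi)} W_e`, the product over the directed edges of the path
from `m` to `i` (the empty product for `i = m` is `1`). -/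
def pathProduct {V Ω : Type*} {T : SimpleGraph V} (hT : T.IsTree) (W : T.Dart → Ω → ℝ) (m : V)
    (ω : Ω) (i : V) : ℝ :=
  ((treePath hT m i).darts.map (fun e => W e ω)).prod

/-- Bivariate duality between `U = W^i_j` and `U' = W^j_i`:
`ℙ(U' ≤ z, U' > 0) = 𝔼(1{1 / U ≤ z} U)` for all `z > 0`. -/
def BivariateDuality {Ω : Type*} [MeasurableSpace Ω] (Q : Measure Ω) (U U' : Ω → ℝ) : Prop :=
  ∀ z : ℝ, 0 < z →
    Q {ω | U' ω ≤ z ∧ 0 < U' ω} = ∫⁻ ω in {ω | 1 / U ω ≤ z}, ENNReal.ofReal (U ω) ∂Q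

end ExtremalTree

end

/-! Representation. Under `Yᵐ`, homogeneity makes the radius `Y_m` standard Pareto and independent
of the profile `Y / Y_m` (`IsMultivariatePareto.map_eval_profile`), so the profile is the extremal
function and the only candidate. A subtree `S` rooted at `m` is then grown one edge `e = (i, j)` at
a time: given `Y_S`, the new coordinate `Y_j` has to be distributed as `Y_i W_e`. Under `Yⁱ` this is
the Markov property combined with `Yⁱ = P Wⁱ`. Scaling by `t` carries it over to `{Y_m > 1, Y_i >
1/t}` (`IsMultivariatePareto.setLIntegral_edge`), and letting `t` grow exhausts `{Y_i > 0}`. The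
event `{Y_i = 0}` cannot be reached by scaling; there `Y_j = 0` has to be shown. Under `Yʲ`,
conditional independence of `Y_j` and `Y_m` given `Y_i = 0` clashes with the joint scaling of the
two: it makes `ℙ(Y_m > t, Y_i = 0)` constant in `t ≥ 1`, hence zero
(`IsMultivariatePareto.measure_zero_edge`).

Construction. Let the radius have the infinite law `r⁻² dr` on `(0, ∞)`, of which the Pareto law is
the part above `1`. The vectors rooted at `m` then have a homogeneous law `Λ_m`. The duality of an
edge says that the pair of values at its two ends has the same law on the open quadrant whichever
end is the root (`LawDuality.lintegral_powerMeasure`). Hence `Λ_m` and `Λ_m'` agree where both root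
coordinates are positive, first for neighbours and then along paths (`treeMeasure_restrict_pos`).
The `Λ_m` glue to one homogeneous measure, and conditioning it on `𝓛` gives `Y`
(`exists_multivariatePareto`). Consistency is read off `Y`, and uniqueness holds because the sets
`{x_m > 1}` cover `𝓛`.

The Markov property of the constructed law is again proved by growing rooted subtrees: a new leaf is
its parent times an independent weight, and the usual rules for conditional independence apply
(`partitionMarkov_univ`). -/

namespace ExtremalTree

set_option linter.unusedSectionVars false

/-! ### Conditional independence expressed by densities. -/

section CondIndep

variable {Ω α β γ δ α' β' γ' : Type*} [MeasurableSpace Ω] [MeasurableSpace α] [MeasurableSpace β]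
  [MeasurableSpace γ] [MeasurableSpace δ] [MeasurableSpace α'] [MeasurableSpace β']
  [MeasurableSpace γ'] {μ : Measure Ω} {X : Ω → α} {Y : Ω → β} {Z : Ω → γ} {W : Ω → δ}

/-- Conditional independence of `X` and `Y` given `Z`: the conditional law of `X` given `(Y, Z)`
depends only on `Z`. -/
def CondIndepVar (X : Ω → α) (Y : Ω → β) (Z : Ω → γ) (μ : Measure Ω) : Prop :=
  ∀ F : Set α, MeasurableSet F → ∃ h : γ → ℝ≥0∞, Measurable h ∧
    (μ.restrict (X ⁻¹' F)).map (fun ω => (Y ω, Z ω)) =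
      (μ.map (fun ω => (Y ω, Z ω))).withDensity (fun p => h p.2)

theorem map_snd_withDensity {ν : Measure (β × γ)} {h : γ → ℝ≥0∞} (hh : Measurable h) :
    (ν.withDensity (fun p => h p.2)).map Prod.snd = (ν.map Prod.snd).withDensity h := by
  ext s hs
  rw [Measure.map_apply measurable_snd hs, withDensity_apply _ (measurable_snd hs),
    withDensity_apply _ hs, setLIntegral_map hs hh measurable_snd]

theorem map_prodMk_snd {ν : Measure Ω} (hY : Measurable Y) (hZ : Measurable Z) :
    (ν.map (fun ω => (Y ω, Z ω))).map Prod.snd = ν.map Z := by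
  rw [Measure.map_map measurable_snd (hY.prodMk hZ)]
  rfl

/-- Integrating `Y` out identifies `h` as a version of the conditional probability of `{X ∈ F}`
given `Z`. -/
theorem CondIndepVar.density_marginal {F : Set α} {h : γ → ℝ≥0∞} (hh : Measurable h)
    (hY : Measurable Y) (hZ : Measurable Z)
    (e : (μ.restrict (X ⁻¹' F)).map (fun ω => (Y ω, Z ω)) =
      (μ.map (fun ω => (Y ω, Z ω))).withDensity (fun p => h p.2)) :
    (μ.restrict (X ⁻¹' F)).map Z = (μ.map Z).withDensity h := by
  rw [← map_prodMk_snd hY hZ, e, map_snd_withDensity hh, map_prodMk_snd hY hZ]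

/-- Any version of the conditional probability of `{X ∈ F}` given `Z` may be used. -/
theorem CondIndepVar.map_restrict_eq [IsFiniteMeasure μ] (H : CondIndepVar X Y Z μ)
    (hY : Measurable Y) (hZ : Measurable Z) {F : Set α} (hF : MeasurableSet F)
    {h : γ → ℝ≥0∞} (hh : Measurable h)
    (e : (μ.restrict (X ⁻¹' F)).map Z = (μ.map Z).withDensity h) :
    (μ.restrict (X ⁻¹' F)).map (fun ω => (Y ω, Z ω)) =
      (μ.map (fun ω => (Y ω, Z ω))).withDensity (fun p => h p.2) := by
  obtain ⟨k, hk, e'⟩ := H F hF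
  have e2 := CondIndepVar.density_marginal hk hY hZ e'
  rw [e, withDensity_eq_iff_of_sigmaFinite hh.aemeasurable hk.aemeasurable] at e2
  rw [e']
  refine withDensity_congr_ae ?_
  rw [← map_prodMk_snd hY hZ] at e2
  exact Filter.EventuallyEq.symm (ae_of_ae_map measurable_snd.aemeasurable e2)

theorem CondIndepVar.exists_density [IsFiniteMeasure μ] (hZ : Measurable Z) (s : Set Ω) :
    ∃ g : γ → ℝ≥0∞, Measurable g ∧ (μ.restrict s).map Z = (μ.map Z).withDensity g := by
  refine ⟨((μ.restrict s).map Z).rnDeriv (μ.map Z), Measure.measurable_rnDeriv _ _, ?_⟩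
  refine (Measure.withDensity_rnDeriv_eq _ _ ?_).symm
  exact (Measure.restrict_le_self.absolutelyContinuous).map hZ

/-- With `h` and `g` versions of the conditional probabilities of `{X ∈ F}` and `{Y ∈ G}` given `Z`,
both sides tested on `F ×ˢ D` equal the integral of `g h` over `D` against the law of `Z`, which is
symmetric. -/
theorem CondIndepVar.symm [IsFiniteMeasure μ] (H : CondIndepVar X Y Z μ)
    (hX : Measurable X) (hY : Measurable Y) (hZ : Measurable Z) : CondIndepVar Y X Z μ := by
  intro G hG
  obtain ⟨g, hg, eg⟩ := CondIndepVar.exists_density (μ := μ) hZ (Y ⁻¹' G)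
  refine ⟨g, hg, ?_⟩
  refine Measure.ext_prod fun {F D} hF hD => ?_
  obtain ⟨h, hh, eh⟩ := H F hF
  have eh' := CondIndepVar.density_marginal hh hY hZ eh
  rw [Measure.map_apply (hX.prodMk hZ) (hF.prod hD),
    Measure.restrict_apply ((hX.prodMk hZ) (hF.prod hD)),
    withDensity_apply _ (hF.prod hD), setLIntegral_map (hF.prod hD) (by fun_prop) (hX.prodMk hZ)]
  have l1 : μ ((fun ω => (X ω, Z ω)) ⁻¹' F ×ˢ D ∩ Y ⁻¹' G) =
      (μ.restrict (X ⁻¹' F)).map (fun ω => (Y ω, Z ω)) (G ×ˢ D) := by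
    rw [Measure.map_apply (hY.prodMk hZ) (hG.prod hD),
      Measure.restrict_apply ((hY.prodMk hZ) (hG.prod hD))]
    congr 1
    ext ω
    simp only [Set.mem_inter_iff, Set.mem_preimage, Set.mem_prod]
    tauto
  have l2 : ∫⁻ ω in (fun ω => (Y ω, Z ω)) ⁻¹' G ×ˢ D, h (Z ω) ∂μ =
      ∫⁻ z in D, h z ∂((μ.restrict (Y ⁻¹' G)).map Z) := by
    rw [setLIntegral_map hD hh hZ, Measure.restrict_restrict (hZ hD)]
    congr 2
    ext ω
    simp only [Set.mem_inter_iff, Set.mem_preimage, Set.mem_prod]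
    tauto
  have l3 : ∫⁻ ω in (fun ω => (X ω, Z ω)) ⁻¹' F ×ˢ D, g (Z ω) ∂μ =
      ∫⁻ z in D, g z ∂((μ.restrict (X ⁻¹' F)).map Z) := by
    rw [setLIntegral_map hD hg hZ, Measure.restrict_restrict (hZ hD)]
    congr 2
    ext ω
    simp only [Set.mem_inter_iff, Set.mem_preimage, Set.mem_prod]
    tauto
  rw [l1, eh, withDensity_apply _ (hG.prod hD),
    setLIntegral_map (hG.prod hD) (by fun_prop) (hY.prodMk hZ), l2, l3, eg, eh',
    restrict_withDensity hD, restrict_withDensity hD,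
    lintegral_withDensity_eq_lintegral_mul _ hg hh, lintegral_withDensity_eq_lintegral_mul _ hh hg,
    mul_comm]

/-- Decomposition and weak union. -/
theorem CondIndepVar.comp (H : CondIndepVar X Y Z μ) (hY : Measurable Y) (hZ : Measurable Z)
    {f : α → α'} (hf : Measurable f) {g : β × γ → β'} (hg : Measurable g) {k : β × γ → γ'}
    (hk : Measurable k) {l : γ' → γ} (hl : Measurable l) (hlk : ∀ ω, l (k (Y ω, Z ω)) = Z ω) :
    CondIndepVar (fun ω => f (X ω)) (fun ω => g (Y ω, Z ω)) (fun ω => k (Y ω, Z ω)) μ := by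
  intro F hF
  obtain ⟨h, hh, e⟩ := H (f ⁻¹' F) (hf hF)
  -- The conditioning variable may absorb part of `Y`, as long as `l` still recovers `Z` from it;
  -- the old density then serves again.
  refine ⟨h ∘ l, hh.comp hl, ?_⟩
  have hgk : Measurable fun p => (g p, k p) := hg.prodMk hk
  have hYZ : Measurable fun ω => (Y ω, Z ω) := hY.prodMk hZ
  ext S hS
  have e2 := DFunLike.congr_fun e ((fun p => (g p, k p)) ⁻¹' S)
  rw [Measure.map_apply hYZ (hgk hS), withDensity_apply _ (hgk hS),
    setLIntegral_map (hgk hS) (by fun_prop) hYZ] at e2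
  have hc : Measurable fun ω => (g (Y ω, Z ω), k (Y ω, Z ω)) := hgk.comp hYZ
  rw [Measure.map_apply hc hS, withDensity_apply _ hS, setLIntegral_map hS (by fun_prop) hc]
  simp only [Function.comp_apply, hlk]
  exact e2

theorem condIndepVar_const (c : α) :
    CondIndepVar (fun _ => c) Y Z μ := by
  intro F hF
  classical
  refine ⟨fun _ => if c ∈ F then 1 else 0, measurable_const, ?_⟩
  by_cases hc : c ∈ F
  · simp [hc]
  · simp [hc]

/-- Adjoining to `Y` a variable independent of everything keeps conditional independence. -/
theorem CondIndepVar.prodMk_of_indepFun [IsFiniteMeasure μ] (H : CondIndepVar X Y Z μ)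
    (hX : Measurable X) (hY : Measurable Y) (hZ : Measurable Z) (hW : Measurable W)
    (hI : IndepFun (fun ω => (X ω, Y ω, Z ω)) W μ) :
    CondIndepVar X (fun ω => (Y ω, W ω)) Z μ := by
  intro F hF
  obtain ⟨h, hh, e⟩ := H F hF
  refine ⟨h, hh, ?_⟩
  ext S hS
  have hV : Measurable fun ω => (X ω, Y ω, Z ω) := by fun_prop
  have hYZ : Measurable fun ω => (Y ω, Z ω) := by fun_prop
  have hYWZ : Measurable fun ω => ((Y ω, W ω), Z ω) := by fun_prop
  have hVW : Measurable fun ω => ((X ω, Y ω, Z ω), W ω) := by fun_prop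
  have law := (indepFun_iff_map_prod_eq_prod_map_map hV.aemeasurable hW.aemeasurable).1 hI
  have key : ∀ φ : (α × β × γ) × δ → ℝ≥0∞, Measurable φ →
      ∫⁻ ω, φ ((X ω, Y ω, Z ω), W ω) ∂μ =
        ∫⁻ w, ∫⁻ ω, φ ((X ω, Y ω, Z ω), w) ∂μ ∂(μ.map W) := by
    intro φ hφ
    rw [← lintegral_map (f := φ) hφ hVW, law, lintegral_prod_symm _ hφ.aemeasurable]
    refine lintegral_congr fun w => ?_
    rw [lintegral_map (f := fun v => φ (v, w)) (by fun_prop) hV]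
  let S' : Set ((α × β × γ) × δ) := (fun q => ((q.1.2.1, q.2), q.1.2.2)) ⁻¹' S
  have hS' : MeasurableSet S' := by
    apply hS.preimage; fun_prop
  have hF' : MeasurableSet ((fun q : (α × β × γ) × δ => q.1.1) ⁻¹' F) := by
    apply hF.preimage; fun_prop
  rw [Measure.map_apply hYWZ hS, Measure.restrict_apply (hYWZ hS), withDensity_apply _ hS,
    setLIntegral_map hS (by fun_prop) hYWZ]
  have a1 := key ((S' ∩ (fun q : (α × β × γ) × δ => q.1.1) ⁻¹' F).indicator 1)
    (measurable_one.indicator (hS'.inter hF'))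
  have a2 := key (S'.indicator fun q => h q.1.2.2) (by
    refine Measurable.indicator ?_ hS'; fun_prop)
  have b1 : ∫⁻ ω, (S' ∩ (fun q : (α × β × γ) × δ => q.1.1) ⁻¹' F).indicator 1
      ((X ω, Y ω, Z ω), W ω) ∂μ = μ ((fun ω => ((Y ω, W ω), Z ω)) ⁻¹' S ∩ X ⁻¹' F) := by
    rw [← lintegral_indicator_one ((hYWZ hS).inter (hX hF))]
    rfl
  have b2 : ∫⁻ ω, (S'.indicator fun q => h q.1.2.2) ((X ω, Y ω, Z ω), W ω) ∂μ =
      ∫⁻ ω in (fun ω => ((Y ω, W ω), Z ω)) ⁻¹' S, h (Z ω) ∂μ := by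
    rw [← lintegral_indicator (hYWZ hS)]
    rfl
  rw [← b1, ← b2, a1, a2]
  -- By independence `W` can be frozen at `w`; what remains is `e` on the section of `S` at `w`.
  refine lintegral_congr fun w => ?_
  have hT : MeasurableSet ((fun p : β × γ => ((p.1, w), p.2)) ⁻¹' S) := by
    apply hS.preimage; fun_prop
  have e2 := DFunLike.congr_fun e ((fun p : β × γ => ((p.1, w), p.2)) ⁻¹' S)
  rw [Measure.map_apply hYZ hT, withDensity_apply _ hT,
    setLIntegral_map hT (by fun_prop) hYZ, Measure.restrict_apply (hYZ hT)] at e2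
  rw [← lintegral_indicator_one ((hYZ hT).inter (hX hF)), ← lintegral_indicator (hYZ hT)] at e2
  exact e2

theorem CondIndepVar.of_map {Ω' : Type*} [MeasurableSpace Ω'] {ν : Measure Ω'} {T : Ω' → Ω}
    (hT : Measurable T) (hX : Measurable X) (hY : Measurable Y) (hZ : Measurable Z)
    (H : CondIndepVar (fun ω => X (T ω)) (fun ω => Y (T ω)) (fun ω => Z (T ω)) ν) :
    CondIndepVar X Y Z (ν.map T) := by
  intro F hF
  obtain ⟨h, hh, e⟩ := H F hF
  refine ⟨h, hh, ?_⟩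
  rw [Measure.restrict_map hT (hX hF), Measure.map_map (hY.prodMk hZ) hT,
    Measure.map_map (hY.prodMk hZ) hT]
  exact e

section Standard

variable [StandardBorelSpace Ω] [StandardBorelSpace α] [Nonempty α] [StandardBorelSpace β]
  [Nonempty β] [IsFiniteMeasure μ]

theorem map_prod_condDistrib_apply {D : Set γ} {F : Set α} {G : Set β} (hD : MeasurableSet D) (hF : MeasurableSet F)
    (hG : MeasurableSet G) :
    ((Kernel.id ×ₖ (condDistrib X Z μ ×ₖ condDistrib Y Z μ)) ∘ₘ μ.map Z) (D ×ˢ F ×ˢ G) =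
      ∫⁻ z in D, condDistrib X Z μ z F * condDistrib Y Z μ z G ∂(μ.map Z) := by
  rw [Measure.bind_apply (hD.prod (hF.prod hG)) (by fun_prop), ← lintegral_indicator hD]
  refine lintegral_congr fun z => ?_
  rw [Kernel.prod_apply_prod, Kernel.prod_apply_prod, Kernel.id_apply, Measure.dirac_apply' _ hD]
  by_cases hz : z ∈ D <;> simp [hz]

theorem condDistrib_density (hX : Measurable X) (hZ : Measurable Z) {F : Set α}
    (hF : MeasurableSet F) :
    (μ.restrict (X ⁻¹' F)).map Z = (μ.map Z).withDensity (fun z => condDistrib X Z μ z F) := by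
  ext D hD
  have := DFunLike.congr_fun (compProd_map_condDistrib (mβ := inferInstance) (X := Z) (Y := X)
    (μ := μ) hX.aemeasurable) (D ×ˢ F)
  rw [Measure.compProd_apply_prod hD hF, Measure.map_apply (hZ.prodMk hX) (hD.prod hF)] at this
  rw [withDensity_apply _ hD, this, Measure.map_apply hZ hD, Measure.restrict_apply (hZ hD)]
  rfl

/-- `CondIndepFun` says that `(Z, X, Y)` is the law of `Z` followed by the product of the two
conditional distributions. On boxes this is the density identity with `condDistrib X Z μ · F` as
density, and any other density may be exchanged for that one. -/
theorem condIndepVar_iff_condIndepFun (hX : Measurable X) (hY : Measurable Y)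
    (hZ : Measurable Z) :
    CondIndepVar X Y Z μ ↔
      CondIndepFun (MeasurableSpace.comap Z inferInstance) hZ.comap_le X Y μ := by
  rw [condIndepFun_iff_map_prod_eq_prod_condDistrib_prod_condDistrib hX hY hZ,
    Measure.ext_prod₃_iff]
  have hm : Measurable fun ω => (Z ω, X ω, Y ω) := by fun_prop
  have lhs : ∀ {D : Set γ} {F : Set α} {G : Set β}, MeasurableSet D → MeasurableSet F →
      MeasurableSet G → μ.map (fun ω => (Z ω, X ω, Y ω)) (D ×ˢ F ×ˢ G) =
        (μ.restrict (X ⁻¹' F)).map (fun ω => (Y ω, Z ω)) (G ×ˢ D) := by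
    intro D F G hD hF hG
    rw [Measure.map_apply hm (hD.prod (hF.prod hG)),
      Measure.map_apply (hY.prodMk hZ) (hG.prod hD),
      Measure.restrict_apply ((hY.prodMk hZ) (hG.prod hD))]
    congr 1
    ext ω
    simp only [Set.mem_inter_iff, Set.mem_preimage, Set.mem_prod]
    tauto
  have rhs : ∀ {D : Set γ} {F : Set α} {G : Set β}, MeasurableSet D → MeasurableSet F →
      MeasurableSet G →
      ((Kernel.id ×ₖ (condDistrib X Z μ ×ₖ condDistrib Y Z μ)) ∘ₘ μ.map Z) (D ×ˢ F ×ˢ G) =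
        (μ.map (fun ω => (Y ω, Z ω))).withDensity
          (fun p => condDistrib X Z μ p.2 F) (G ×ˢ D) := by
    intro D F G hD hF hG
    have m1' : Measurable (fun z => condDistrib X Z μ z F) := Kernel.measurable_coe _ hF
    have m2' : Measurable (fun z => condDistrib Y Z μ z G) := Kernel.measurable_coe _ hG
    rw [map_prod_condDistrib_apply hD hF hG, withDensity_apply _ (hG.prod hD),
      setLIntegral_map (hG.prod hD) (by fun_prop) (hY.prodMk hZ)]
    have : ∫⁻ ω in (fun ω => (Y ω, Z ω)) ⁻¹' G ×ˢ D, condDistrib X Z μ (Z ω) F ∂μ =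
        ∫⁻ z in D, condDistrib X Z μ z F ∂((μ.restrict (Y ⁻¹' G)).map Z) := by
      rw [setLIntegral_map hD m1' hZ, Measure.restrict_restrict (hZ hD)]
      congr 2
      ext ω
      simp only [Set.mem_inter_iff, Set.mem_preimage, Set.mem_prod]
      tauto
    rw [this, condDistrib_density hY hZ hG, restrict_withDensity hD,
      lintegral_withDensity_eq_lintegral_mul _ m2' m1']
    simp only [Pi.mul_apply, mul_comm]
  constructor
  · intro H D F G hD hF hG
    rw [lhs hD hF hG, rhs hD hF hG, H.map_restrict_eq hY hZ hF (Kernel.measurable_coe _ hF)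
      (condDistrib_density hX hZ hF)]
  · intro H F hF
    refine ⟨fun z => condDistrib X Z μ z F, Kernel.measurable_coe _ hF, ?_⟩
    refine Measure.ext_prod fun {G D} hG hD => ?_
    rw [← lhs hD hF hG, ← rhs hD hF hG, H hD hF hG]

end Standard

end CondIndep

/-! ### Paths, rooted subtrees and path products in a tree. -/

section Tree

variable {V : Type*} {T : SimpleGraph V}

theorem treePath_isPath (hT : T.IsTree) (v w : V) : (treePath hT v w).IsPath :=
  (hT.existsUnique_path v w).choose_spec.1

theorem eq_treePath (hT : T.IsTree) {v w : V} {p : T.Walk v w} (hp : p.IsPath) : p = treePath hT v w :=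
  (hT.existsUnique_path v w).choose_spec.2 p hp

theorem length_treePath (hT : T.IsTree) (v w : V) : (treePath hT v w).length = T.dist v w := by
  obtain ⟨p, hp⟩ := hT.connected.exists_walk_length_eq_dist v w
  rw [← eq_treePath hT (p.isPath_of_length_eq_dist hp), hp]

theorem treePath_self (hT : T.IsTree) (v : V) : treePath hT v v = .nil :=
  (eq_treePath hT SimpleGraph.Walk.IsPath.nil).symm

/-- A walk whose length is the distance is a path, and paths in a tree are unique. -/
theorem treePath_snd (hT : T.IsTree) {m : V} {e : T.Dart} (he : e ∈ outwardEdges T m) :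
    treePath hT m e.snd = (treePath hT m e.fst).concat e.adj := by
  refine (eq_treePath hT (SimpleGraph.Walk.isPath_of_length_eq_dist _ ?_)).symm
  rw [SimpleGraph.Walk.length_concat, length_treePath]
  exact he.symm

theorem treePath_cons (hT : T.IsTree) {m m' v : V} (h : T.Adj m m') (hd : T.dist m v = T.dist m' v + 1) :
    treePath hT m v = .cons h (treePath hT m' v) := by
  refine (eq_treePath hT (SimpleGraph.Walk.isPath_of_length_eq_dist _ ?_)).symm
  rw [SimpleGraph.Walk.length_cons, length_treePath, hd]

/-- Decides on which side of the edge `v` lies, and so which of the two paths to `v` crosses it. -/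
theorem dist_adj_cases (hT : T.IsTree) {m m' : V} (h : T.Adj m m') (v : V) :
    T.dist m v = T.dist m' v + 1 ∨ T.dist m' v = T.dist m v + 1 := by
  have := hT.dist_eq_dist_add_one_of_adj v h
  rwa [SimpleGraph.dist_comm (u := v) (v := m), SimpleGraph.dist_comm (u := v) (v := m')] at this

theorem exists_outwardEdge_snd (hT : T.IsTree) {m v : V} (hv : v ≠ m) :
    ∃ e ∈ outwardEdges T m, e.snd = v := by
  obtain ⟨p, hp⟩ := hT.connected.exists_walk_length_eq_dist v m
  cases p with
  | nil => exact absurd rfl hv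
  | @cons _ u _ h q =>
    refine ⟨⟨(u, v), h.symm⟩, ?_, rfl⟩
    change T.dist m v = T.dist m u + 1
    rw [SimpleGraph.Walk.length_cons] at hp
    have h1 : T.dist u m ≤ q.length := SimpleGraph.dist_le q
    rw [SimpleGraph.dist_comm (u := m), SimpleGraph.dist_comm (u := m)]
    have := dist_adj_cases hT h m
    omega

theorem outward_induction (hT : T.IsTree) {m : V} {motive : V → Prop} (base : motive m)
    (step : ∀ e ∈ outwardEdges T m, motive e.fst → motive e.snd) (v : V) : motive v := by
  induction hn : T.dist m v using Nat.strong_induction_on generalizing v with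
  | _ n ih =>
    by_cases hv : v = m
    · rwa [hv]
    · obtain ⟨e, he, rfl⟩ := exists_outwardEdge_snd hT hv
      have he' : T.dist m e.snd = T.dist m e.fst + 1 := he
      exact step e he (ih _ (by omega) _ rfl)

/-- `S` contains the root `m` and is closed under taking parents. -/
structure IsRootedSubtree (T : SimpleGraph V) (m : V) (S : Set V) : Prop where
  root_mem : m ∈ S
  fst_mem : ∀ e ∈ outwardEdges T m, e.snd ∈ S → e.fst ∈ S

/-- A vertex of `S` farthest from the root has no child in `S`, so deleting it leaves a rooted
subtree; every rooted subtree thus arises from `{m}` by adding leaves. -/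
theorem rootedSubtree_induction [Finite V] (hT : T.IsTree) {m : V} {motive : Set V → Prop}
    (base : motive {m})
    (step : ∀ S, IsRootedSubtree T m S → ∀ e ∈ outwardEdges T m, e.fst ∈ S → e.snd ∉ S →
      motive S → motive (insert e.snd S)) : motive Set.univ := by
  suffices H : ∀ n : ℕ, ∀ S : Set V, IsRootedSubtree T m S → S.ncard = n → motive S from
    H _ Set.univ ⟨trivial, fun _ _ _ => trivial⟩ rfl
  intro n
  induction n with
  | zero =>
    intro S hS hn
    rw [Set.ncard_eq_zero] at hn
    exact absurd hS.root_mem (by simp [hn])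
  | succ n ih =>
    intro S hS hn
    by_cases hm : S = {m}
    · rwa [hm]
    have hne : (S \ {m}).Nonempty := by
      by_contra hc
      rw [Set.not_nonempty_iff_eq_empty, Set.sdiff_eq_empty] at hc
      exact hm (Set.Subset.antisymm hc (Set.singleton_subset_iff.2 hS.root_mem))
    obtain ⟨j, ⟨hjS, hjm⟩, hj⟩ :=
      Set.exists_max_image (S \ {m}) (fun v => T.dist m v) (Set.toFinite _) hne
    obtain ⟨e, he, rfl⟩ := exists_outwardEdge_snd hT hjm
    have he' : T.dist m e.snd = T.dist m e.fst + 1 := he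
    have hsub : IsRootedSubtree T m (S \ {e.snd}) := by
      refine ⟨⟨hS.root_mem, fun h => hjm h.symm⟩, fun d hd hdS => ⟨hS.fst_mem d hd hdS.1, ?_⟩⟩
      intro hde
      have hd' : T.dist m d.snd = T.dist m d.fst + 1 := hd
      have hdm : d.snd ∉ ({m} : Set V) := by
        intro h
        rw [Set.mem_singleton_iff.1 h, SimpleGraph.dist_self] at hd'
        omega
      have := hj d.snd ⟨hdS.1, hdm⟩
      rw [Set.mem_singleton_iff.1 hde] at hd'
      omega
    have hfst : e.fst ∈ S \ {e.snd} := ⟨hS.fst_mem e he hjS, fun h => e.adj.ne h⟩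
    have := step _ hsub e he hfst (fun h => h.2 rfl) (ih _ hsub (by
      rw [Set.ncard_sdiff_singleton_of_mem hjS, hn]; rfl))
    rwa [Set.insert_sdiff_singleton, Set.insert_eq_of_mem hjS] at this

theorem IsRootedSubtree.support_subset (hT : T.IsTree) {m : V} {S : Set V} (hS : IsRootedSubtree T m S) {v : V}
    (hv : v ∈ S) : ∀ u ∈ (treePath hT m v).support, u ∈ S := by
  induction v using outward_induction hT (m := m) with
  | base => simpa [treePath_self] using hS.root_mem
  | step e he ih =>
    intro u hu
    rw [treePath_snd hT he, SimpleGraph.Walk.support_concat,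
      List.mem_append, List.mem_singleton] at hu
    rcases hu with hu | rfl
    · exact ih (hS.fst_mem e he hv) u hu
    · exact hv

theorem IsRootedSubtree.darts_outward (hT : T.IsTree) {m : V} {S : Set V} (hS : IsRootedSubtree T m S) {v : V}
    (hv : v ∈ S) : ∀ d ∈ (treePath hT m v).darts, d ∈ outwardEdges T m ∧ d.snd ∈ S := by
  induction v using outward_induction hT (m := m) with
  | base => simp [treePath_self]
  | step e he ih =>
    intro d hd
    rw [treePath_snd hT he, SimpleGraph.Walk.darts_concat, List.concat_eq_append,
      List.mem_append, List.mem_singleton] at hd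
    rcases hd with hd | rfl
    · exact ih (hS.fst_mem e he hv) d hd
    · exact ⟨he, hv⟩

/-- The tail of an outward edge leaving a rooted subtree separates its head from the subtree. -/
theorem IsRootedSubtree.fst_mem_support (hT : T.IsTree) {m : V} {S : Set V} (hS : IsRootedSubtree T m S)
    {e : T.Dart} (hi : e.fst ∈ S) (hj : e.snd ∉ S) {c : V} (hc : c ∈ S)
    (p : T.Walk e.snd c) (hp : p.IsPath) : e.fst ∈ p.support := by
  classical
  by_contra hn
  -- If `p` missed the tail of `e`, prefixing `e` would give the unique path from the tail to `c`.
  -- That path also comes from shortcutting the detour through the root, which stays in `S` and so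
  -- cannot visit the head of `e`.
  have h1 := eq_treePath hT (p := .cons e.adj p)
    ((SimpleGraph.Walk.cons_isPath_iff _ _).2 ⟨hp, hn⟩)
  let q := (treePath hT m e.fst).reverse.append (treePath hT m c)
  have h2 := eq_treePath hT q.bypass_isPath
  have h3 : e.snd ∈ q.bypass.support := by
    rw [h2, ← h1]
    simp
  have h4 := q.support_bypass_subset_support h3
  rw [SimpleGraph.Walk.mem_support_append_iff, SimpleGraph.Walk.support_reverse,
    List.mem_reverse] at h4
  rcases h4 with h4 | h4
  · exact hj (hS.support_subset hT hi _ h4)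
  · exact hj (hS.support_subset hT hc _ h4)

theorem IsRootedSubtree.separates (hT : T.IsTree) {m : V} {S : Set V} (hS : IsRootedSubtree T m S)
    {e : T.Dart} (hi : e.fst ∈ S) (hj : e.snd ∉ S) :
    Separates T {e.snd} {e.fst} (S \ {e.fst}) := by
  rintro a rfl c hc p hp
  exact ⟨e.fst, rfl, hS.fst_mem_support hT hi hj hc.1 p hp⟩

/-- The product of the edge weights `w` along the path from `m` to `i`. -/
noncomputable def edgeProd (hT : T.IsTree) (m : V) (w : T.Dart → ℝ) (i : V) : ℝ :=
  ((treePath hT m i).darts.map w).prod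

@[simp]
theorem edgeProd_self (hT : T.IsTree) (m : V) (w : T.Dart → ℝ) : edgeProd hT m w m = 1 := by
  simp [edgeProd, treePath_self]

theorem edgeProd_snd (hT : T.IsTree) {m : V} {e : T.Dart} (he : e ∈ outwardEdges T m) (w : T.Dart → ℝ) :
    edgeProd hT m w e.snd = edgeProd hT m w e.fst * w e := by
  simp [edgeProd, treePath_snd hT he]

theorem edgeProd_cons (hT : T.IsTree) {m m' v : V} (h : T.Adj m m') (hd : T.dist m v = T.dist m' v + 1)
    (w : T.Dart → ℝ) : edgeProd hT m w v = w ⟨(m, m'), h⟩ * edgeProd hT m' w v := by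
  simp [edgeProd, treePath_cons hT h hd]

theorem IsRootedSubtree.edgeProd_congr (hT : T.IsTree) {m : V} {S : Set V} (hS : IsRootedSubtree T m S) {v : V}
    (hv : v ∈ S) {w w' : T.Dart → ℝ} (h : ∀ d ∈ outwardEdges T m, d.snd ∈ S → w d = w' d) :
    edgeProd hT m w v = edgeProd hT m w' v := by
  unfold edgeProd
  congr 1
  refine List.map_congr_left fun d hd => ?_
  obtain ⟨h1, h2⟩ := hS.darts_outward hT hv d hd
  exact h d h1 h2

theorem edgeProd_congr_outward (hT : T.IsTree) {m v : V} {w w' : T.Dart → ℝ}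
    (h : ∀ d ∈ outwardEdges T m, w d = w' d) : edgeProd hT m w v = edgeProd hT m w' v :=
  IsRootedSubtree.edgeProd_congr hT (S := Set.univ) ⟨trivial, fun _ _ _ => trivial⟩ trivial
    fun d hd _ => h d hd

/-- For `v` on the side of `m`, the path from `m'` to `v` starts by stepping to `m` and never
returns, so the path from `m` to `v` uses no dart at `m'`. -/
theorem edgeProd_update (hT : T.IsTree) [DecidableEq T.Dart] {m m' v : V} (h : T.Adj m m')
    (hd : T.dist m' v = T.dist m v + 1) {d : T.Dart} (hm : m' = d.fst ∨ m' = d.snd)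
    (w : T.Dart → ℝ) (u : ℝ) :
    edgeProd hT m (Function.update w d u) v = edgeProd hT m w v := by
  unfold edgeProd
  congr 1
  refine List.map_congr_left fun d' hd' => ?_
  refine Function.update_of_ne ?_ _ _
  rintro rfl
  have hp := treePath_isPath hT m' v
  rw [treePath_cons hT h.symm hd, SimpleGraph.Walk.cons_isPath_iff] at hp
  rcases hm with rfl | rfl
  · exact hp.2 (SimpleGraph.Walk.dart_fst_mem_support_of_mem_darts _ hd')
  · exact hp.2 (SimpleGraph.Walk.dart_snd_mem_support_of_mem_darts _ hd')

theorem edgeProd_nonneg (hT : T.IsTree) {w : T.Dart → ℝ} (hw : ∀ d, 0 ≤ w d) (m v : V) :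
    0 ≤ edgeProd hT m w v := by
  refine List.prod_nonneg fun x hx => ?_
  obtain ⟨d, -, rfl⟩ := List.mem_map.1 hx
  exact hw d

@[fun_prop]
theorem measurable_edgeProd (hT : T.IsTree) (m v : V) : Measurable fun w : T.Dart → ℝ => edgeProd hT m w v := by
  unfold edgeProd
  induction (treePath hT m v).darts with
  | nil => simp
  | cons d l ih =>
    simp only [List.map_cons, List.prod_cons]
    exact (measurable_pi_apply d).mul ih

end Tree

/-! ### The homogeneous radial measure `r⁻² dr`. -/

section Power

/-- The measure on `(0, ∞)` with density `r⁻²`. -/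
noncomputable def powerMeasure : Measure ℝ :=
  (volume.restrict (Set.Ioi 0)).withDensity fun r => ENNReal.ofReal ((r ^ 2)⁻¹)

instance : SigmaFinite powerMeasure :=
  inferInstanceAs (SigmaFinite ((volume.restrict (Set.Ioi (0 : ℝ))).withDensity
    fun r => ENNReal.ofReal ((r ^ 2)⁻¹)))

instance : IsProbabilityMeasure stdPareto :=
  isProbabilityMeasure_paretoMeasure one_pos one_pos

theorem ae_powerMeasure_pos : ∀ᵐ r ∂powerMeasure, 0 < r := by
  refine (withDensity_absolutelyContinuous _ _).ae_le ?_
  exact ae_restrict_mem measurableSet_Ioi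

theorem stdPareto_eq_restrict : stdPareto = powerMeasure.restrict (Set.Ioi 1) := by
  rw [stdPareto, paretoMeasure, powerMeasure, restrict_withDensity measurableSet_Ioi,
    Measure.restrict_restrict measurableSet_Ioi,
    Set.inter_eq_left.2 (Set.Ioi_subset_Ioi zero_le_one), ← withDensity_indicator measurableSet_Ioi]
  refine withDensity_congr_ae ?_
  -- The Pareto density is positive at the endpoint `1`, which the open half-line omits; the point
  -- is null.
  have h1 : ∀ᵐ x : ℝ, x ≠ 1 := by
    simp [ae_iff]
  filter_upwards [h1] with x hx
  rcases lt_or_gt_of_ne hx with h | h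
  · rw [paretoPDF_of_lt h, Set.indicator_of_notMem (by simpa using h.le)]
  · rw [paretoPDF_of_le h.le, Set.indicator_of_mem (by simpa using h)]
    congr 1
    have h0 : (0 : ℝ) ≤ x := by linarith
    rw [show (-(1 + 1) : ℝ) = -(2 : ℕ) by norm_num, Real.rpow_neg h0, Real.rpow_natCast]
    simp

/-- Under `s = c r` the density contributes `c²` and Lebesgue measure `c⁻¹`. -/
theorem lintegral_powerMeasure_mul {f : ℝ → ℝ≥0∞} (hf : Measurable f) {c : ℝ} (hc : 0 < c) :
    ∫⁻ r, f (c * r) ∂powerMeasure = ENNReal.ofReal c * ∫⁻ r, f r ∂powerMeasure := by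
  have expand : ∀ g : ℝ → ℝ≥0∞, Measurable g → ∫⁻ r, g r ∂powerMeasure =
      ∫⁻ r, (Set.Ioi 0).indicator (fun r => ENNReal.ofReal ((r ^ 2)⁻¹) * g r) r := by
    intro g hg
    rw [powerMeasure, lintegral_withDensity_eq_lintegral_mul _ (by fun_prop) hg,
      lintegral_indicator measurableSet_Ioi]
    rfl
  have hm : Measurable ((Set.Ioi 0).indicator
      (fun r : ℝ => ENNReal.ofReal ((r ^ 2)⁻¹) * f r)) :=
    Measurable.indicator (by fun_prop) measurableSet_Ioi
  rw [expand _ (by fun_prop), expand _ hf]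
  have hpt : ∀ r : ℝ, (Set.Ioi 0).indicator
      (fun r => ENNReal.ofReal ((r ^ 2)⁻¹) * f (c * r)) r = ENNReal.ofReal (c ^ 2) *
      (Set.Ioi 0).indicator (fun r => ENNReal.ofReal ((r ^ 2)⁻¹) * f r) (c * r) := by
    intro r
    by_cases hr : 0 < r
    · rw [Set.indicator_of_mem (by exact hr), Set.indicator_of_mem (by exact mul_pos hc hr),
        ← mul_assoc, ← ENNReal.ofReal_mul (by positivity)]
      congr 2
      field_simp
    · rw [Set.indicator_of_notMem (by exact hr), Set.indicator_of_notMem, mul_zero]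
      intro h
      exact hr ((mul_pos_iff_of_pos_left hc).1 h)
  simp_rw [hpt]
  rw [lintegral_const_mul _ (by fun_prop),
    ← lintegral_map (g := fun r => c * r) hm (by fun_prop), Real.map_volume_mul_left hc.ne',
    lintegral_smul_measure, smul_eq_mul, ← mul_assoc, ← ENNReal.ofReal_mul (by positivity),
    abs_of_pos (inv_pos.2 hc)]
  congr 2
  field_simp

theorem powerMeasure_Ioi {t : ℝ} (ht : 0 < t) :
    powerMeasure (Set.Ioi t) = (ENNReal.ofReal t)⁻¹ := by
  have h1 : powerMeasure (Set.Ioi 1) = 1 := by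
    rw [← Measure.restrict_apply_univ, ← stdPareto_eq_restrict, measure_univ]
  have h := lintegral_powerMeasure_mul (f := (Set.Ioi t).indicator 1)
    (measurable_one.indicator measurableSet_Ioi) ht
  rw [lintegral_indicator_one measurableSet_Ioi] at h
  have h2 : ∫⁻ r, (Set.Ioi t).indicator 1 (t * r) ∂powerMeasure = powerMeasure (Set.Ioi 1) := by
    rw [← lintegral_indicator_one measurableSet_Ioi]
    refine lintegral_congr fun r => ?_
    have : t < t * r ↔ 1 < r := by
      constructor <;> intro h <;> nlinarith
    by_cases hr : 1 < r
    · rw [Set.indicator_of_mem (by exact this.2 hr), Set.indicator_of_mem (by exact hr)]; rfl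
    · rw [Set.indicator_of_notMem (by exact fun h => hr (this.1 h)),
        Set.indicator_of_notMem (by exact hr)]
  rw [h2, h1, mul_comm] at h
  exact ENNReal.eq_inv_of_mul_eq_one_left h.symm

theorem stdPareto_Ioi {t : ℝ} (ht : 1 ≤ t) : stdPareto (Set.Ioi t) = (ENNReal.ofReal t)⁻¹ := by
  rw [stdPareto_eq_restrict, Measure.restrict_apply measurableSet_Ioi,
    Set.inter_eq_left.2 (Set.Ioi_subset_Ioi ht), powerMeasure_Ioi (by linarith)]

theorem ae_stdPareto_gt_one : ∀ᵐ r ∂stdPareto, 1 < r := by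
  rw [stdPareto_eq_restrict]
  exact ae_restrict_mem measurableSet_Ioi

end Power

/-! ### Duality across an edge as a change of variables. -/

section Duality

/-- Duality of the laws of the two extremal functions attached to an edge. -/
def LawDuality (ν ν' : Measure ℝ) : Prop :=
  ∀ z : ℝ, 0 < z → ν' (Set.Ioc 0 z) = ∫⁻ u in {u | 1 / u ≤ z}, ENNReal.ofReal u ∂ν

theorem BivariateDuality.lawDuality {Ω : Type*} [MeasurableSpace Ω] {Q : Measure Ω}
    {U U' : Ω → ℝ} (h : BivariateDuality Q U U') (hU : Measurable U) (hU' : Measurable U') :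
    LawDuality (Q.map U) (Q.map U') := by
  intro z hz
  have hs : MeasurableSet {u : ℝ | 1 / u ≤ z} := measurableSet_le (by fun_prop) (by fun_prop)
  rw [Measure.map_apply hU' measurableSet_Ioc, setLIntegral_map hs (by fun_prop) hU]
  rw [show U ⁻¹' {u | 1 / u ≤ z} = {ω | 1 / U ω ≤ z} from rfl, ← h z hz]
  congr 1
  ext ω
  simp [and_comm]

/-- On `(0, ∞)`, `ν'` is the image of `u ν(du)` under inversion: the hypothesis says so on
half-lines, and these determine the measure. -/
theorem LawDuality.lintegral_eq {ν ν' : Measure ℝ} [IsFiniteMeasure ν'] (h : LawDuality ν ν')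
    {g : ℝ → ℝ≥0∞} (hg : Measurable g) :
    ∫⁻ u in Set.Ioi 0, g u ∂ν' = ∫⁻ u in Set.Ioi 0, ENNReal.ofReal u * g u⁻¹ ∂ν := by
  have key : ν'.restrict (Set.Ioi 0) =
      ((ν.restrict (Set.Ioi 0)).withDensity ENNReal.ofReal).map (fun u => u⁻¹) := by
    refine Measure.ext_of_Iic _ _ fun z => ?_
    have hpre : MeasurableSet ((fun u : ℝ => u⁻¹) ⁻¹' Set.Iic z) := by
      apply measurableSet_Iic.preimage; fun_prop
    rw [Measure.map_apply (by fun_prop) measurableSet_Iic, withDensity_apply _ hpre,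
      Measure.restrict_restrict hpre, Measure.restrict_apply measurableSet_Iic]
    rcases le_or_gt z 0 with hz | hz
    · have e1 : Set.Iic z ∩ Set.Ioi 0 = ∅ := by
        ext x
        simp only [Set.mem_inter_iff, Set.mem_Iic, Set.mem_Ioi, Set.mem_empty_iff_false, iff_false]
        intro hx; linarith [hx.1, hx.2]
      have e2 : (fun u : ℝ => u⁻¹) ⁻¹' Set.Iic z ∩ Set.Ioi 0 = ∅ := by
        ext x
        simp only [Set.mem_inter_iff, Set.mem_preimage, Set.mem_Iic, Set.mem_Ioi,
          Set.mem_empty_iff_false, iff_false]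
        intro hx
        linarith [hx.1, inv_pos.2 hx.2]
      rw [e1, e2]
      simp
    · rw [show Set.Iic z ∩ Set.Ioi 0 = Set.Ioc 0 z by ext; simp [and_comm], h z hz]
      have hs : MeasurableSet {u : ℝ | 1 / u ≤ z} := measurableSet_le (by fun_prop) (by fun_prop)
      rw [← lintegral_indicator hs, ← lintegral_indicator (hpre.inter measurableSet_Ioi)]
      refine lintegral_congr fun u => ?_
      by_cases hu : 0 < u
      · by_cases huz : u⁻¹ ≤ z
        · rw [Set.indicator_of_mem (by simpa using huz),
            Set.indicator_of_mem (by exact ⟨huz, hu⟩)]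
        · rw [Set.indicator_of_notMem (by simpa using huz),
            Set.indicator_of_notMem (by exact fun h => huz h.1)]
      · rw [Set.indicator_of_notMem (s := _ ∩ _) (by exact fun h => hu h.2)]
        -- For `u ≤ 0`, including `u = 0` where `1 / 0 = 0`, the condition `1 / u ≤ z` holds, but
        -- the weight `ENNReal.ofReal u` vanishes.
        by_cases huz : u⁻¹ ≤ z
        · rw [Set.indicator_of_mem (by simpa using huz), ENNReal.ofReal_of_nonpos (not_lt.1 hu)]
        · rw [Set.indicator_of_notMem (by simpa using huz)]
  rw [key, lintegral_map hg (by fun_prop),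
    lintegral_withDensity_eq_lintegral_mul _ (by fun_prop) (by fun_prop)]
  rfl

/-- Rescaling the radius by `u` costs a factor `u` under `r⁻² dr`, and this is exactly the weight in
the duality. So the values at the two ends of an edge have one joint law on the open quadrant,
whichever end carries the radius. -/
theorem LawDuality.lintegral_powerMeasure {ν ν' : Measure ℝ} [IsFiniteMeasure ν]
    [IsFiniteMeasure ν'] (h : LawDuality ν ν') {H : ℝ × ℝ → ℝ≥0∞} (hH : Measurable H) :
    ∫⁻ r, ∫⁻ u in Set.Ioi 0, H (r, r * u) ∂ν ∂powerMeasure =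
      ∫⁻ r, ∫⁻ u in Set.Ioi 0, H (r * u, r) ∂ν' ∂powerMeasure := by
  rw [lintegral_lintegral_swap (f := fun r u => H (r, r * u)) (by fun_prop),
    lintegral_lintegral_swap (f := fun r u => H (r * u, r)) (by fun_prop),
    h.lintegral_eq (g := fun u => ∫⁻ r, H (r * u, r) ∂powerMeasure)
      (Measurable.lintegral_prod_right' (f := fun p : ℝ × ℝ => H (p.2 * p.1, p.2)) (by fun_prop))]
  refine setLIntegral_congr_fun measurableSet_Ioi fun u hu => ?_
  have hu' : (0 : ℝ) < u := hu
  have := lintegral_powerMeasure_mul (f := fun s => H (s * u⁻¹, s)) (by fun_prop) hu'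
  rw [← this]
  refine lintegral_congr fun r => ?_
  congr 2
  · field_simp
  · ring

end Duality

/-! ### Redrawing one coordinate of a product measure. -/

section Resample

variable {ι : Type*} [Fintype ι] [DecidableEq ι]

theorem map_update_prod_pi (ν : ι → Measure ℝ) [∀ i, IsProbabilityMeasure (ν i)] (d : ι) :
    ((ν d).prod (Measure.pi ν)).map (fun p => Function.update p.2 d p.1) = Measure.pi ν := by
  refine (Measure.pi_eq fun s hs => ?_).symm
  have hpre : (fun p : ℝ × (ι → ℝ) => Function.update p.2 d p.1) ⁻¹' Set.univ.pi s =
      s d ×ˢ Set.univ.pi (Function.update s d Set.univ) := by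
    ext ⟨u, w⟩
    simp only [Set.mem_preimage, Set.mem_pi, Set.mem_univ, true_implies, Set.mem_prod]
    constructor
    · intro H
      refine ⟨by simpa using H d, fun i => ?_⟩
      by_cases hi : i = d
      · subst hi; simp
      · simpa [hi] using H i
    · rintro ⟨h1, h2⟩ i
      by_cases hi : i = d
      · subst hi; simpa using h1
      · simpa [hi] using h2 i
  have hm : Measurable fun p : ℝ × (ι → ℝ) => Function.update p.2 d p.1 := by
    rw [measurable_pi_iff]
    intro i
    by_cases hi : i = d
    · subst hi; simpa using measurable_fst
    · simp only [Function.update_of_ne hi]; fun_prop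
  rw [Measure.map_apply hm (MeasurableSet.univ_pi hs), hpre, Measure.prod_prod, Measure.pi_pi,
    Fintype.prod_eq_mul_prod_compl d (fun i => ν i (s i)),
    Fintype.prod_eq_mul_prod_compl d (fun i => ν i (Function.update s d Set.univ i)),
    Function.update_self, measure_univ, one_mul]
  congr 1
  refine Finset.prod_congr rfl fun i hi => ?_
  rw [Function.update_of_ne (by simpa using hi)]

/-- Isolates the weight of one dart while all others stay frozen, without splitting the index set.
-/
theorem lintegral_pi_resample (ν : ι → Measure ℝ) [∀ i, IsProbabilityMeasure (ν i)] (d : ι)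
    {f : (ι → ℝ) → ℝ≥0∞} (hf : Measurable f) :
    ∫⁻ w, f w ∂(Measure.pi ν) =
      ∫⁻ w, ∫⁻ u, f (Function.update w d u) ∂(ν d) ∂(Measure.pi ν) := by
  have hm : Measurable fun p : ℝ × (ι → ℝ) => Function.update p.2 d p.1 := by
    rw [measurable_pi_iff]
    intro i
    by_cases hi : i = d
    · subst hi; simpa using measurable_fst
    · simp only [Function.update_of_ne hi]; fun_prop
  conv_lhs => rw [← map_update_prod_pi ν d]
  have hfm : Measurable fun p : ℝ × (ι → ℝ) => f (Function.update p.2 d p.1) := hf.comp hm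
  rw [lintegral_map hf hm, lintegral_prod_symm _ hfm.aemeasurable]

end Resample

/-! ### Laws of tree vectors and change of root. -/

section TreeMeasure

variable {V : Type*} {T : SimpleGraph V}

/-- The vector `(r ∏_{e ∈ ph(mi)} w_e)_i` as a function of `(r, w)`. -/
noncomputable def treeVec (hT : T.IsTree) (m : V) (q : ℝ × (T.Dart → ℝ)) (i : V) : ℝ :=
  q.1 * edgeProd hT m q.2 i

@[fun_prop]
theorem measurable_treeVec (hT : T.IsTree) (m : V) : Measurable (treeVec hT m) := by
  rw [measurable_pi_iff]
  intro i
  exact measurable_fst.mul ((measurable_edgeProd hT m i).comp measurable_snd)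

@[simp]
theorem treeVec_root (hT : T.IsTree) (m : V) (q : ℝ × (T.Dart → ℝ)) : treeVec hT m q m = q.1 := by
  simp [treeVec]

theorem treeVec_snd (hT : T.IsTree) {m : V} {e : T.Dart} (he : e ∈ outwardEdges T m)
    (q : ℝ × (T.Dart → ℝ)) : treeVec hT m q e.snd = treeVec hT m q e.fst * q.2 e := by
  simp only [treeVec, edgeProd_snd hT he]
  ring

theorem treeVec_nonneg (hT : T.IsTree) {q : ℝ × (T.Dart → ℝ)} (h1 : 0 ≤ q.1)
    (h2 : ∀ d, 0 ≤ q.2 d) (m i : V) : 0 ≤ treeVec hT m q i :=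
  mul_nonneg h1 (edgeProd_nonneg hT h2 m i)

variable [Fintype T.Dart]

/-- The law of `(R ∏_{e ∈ ph(mi)} W_e)_i`, for independent `R ∼ ρ` and `W_e ∼ ν e`. -/
noncomputable def treeMeasure (hT : T.IsTree) (m : V) (ρ : Measure ℝ) (ν : T.Dart → Measure ℝ) :
    Measure (V → ℝ) :=
  (ρ.prod (Measure.pi ν)).map (treeVec hT m)

variable (hT : T.IsTree) {ρ : Measure ℝ} {ν : T.Dart → Measure ℝ}

theorem lintegral_treeMeasure [SFinite ρ] [∀ e, IsProbabilityMeasure (ν e)] (m : V)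
    {f : (V → ℝ) → ℝ≥0∞} (hf : Measurable f) :
    ∫⁻ x, f x ∂(treeMeasure hT m ρ ν) =
      ∫⁻ r, ∫⁻ w, f (treeVec hT m (r, w)) ∂(Measure.pi ν) ∂ρ := by
  rw [treeMeasure, lintegral_map hf (by fun_prop), lintegral_prod _ (by fun_prop)]

theorem ae_treeMeasure_of [SFinite ρ] [∀ e, IsProbabilityMeasure (ν e)]
    (hν : ∀ e, ∀ᵐ u ∂(ν e), 0 ≤ u) (hρ : ∀ᵐ r ∂ρ, 0 < r) (m : V) {p : (V → ℝ) → Prop}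
    (hp : MeasurableSet {x | p x})
    (h : ∀ q : ℝ × (T.Dart → ℝ), 0 < q.1 → (∀ d, 0 ≤ q.2 d) → p (treeVec hT m q)) :
    ∀ᵐ x ∂(treeMeasure hT m ρ ν), p x := by
  rw [treeMeasure, ae_map_iff (by fun_prop) hp]
  have h1 : ∀ᵐ q ∂(ρ.prod (Measure.pi ν)), 0 < q.1 :=
    Measure.quasiMeasurePreserving_fst.ae hρ
  have h2 : ∀ᵐ q ∂(ρ.prod (Measure.pi ν)), ∀ d, 0 ≤ q.2 d :=
    Measure.quasiMeasurePreserving_snd.ae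
      (ae_all_iff.2 fun d => (measurePreserving_eval ν d).quasiMeasurePreserving.ae (hν d))
  filter_upwards [h1, h2] with q hq1 hq2 using h q hq1 hq2

theorem treeMeasure_restrict_root [SFinite ρ] [∀ e, IsProbabilityMeasure (ν e)] (m : V)
    {s : Set ℝ} (hs : MeasurableSet s) :
    (treeMeasure hT m ρ ν).restrict {x | x m ∈ s} = treeMeasure hT m (ρ.restrict s) ν := by
  have hm : MeasurableSet {x : V → ℝ | x m ∈ s} := measurable_pi_apply m hs
  rw [treeMeasure, Measure.restrict_map (by fun_prop) hm, treeMeasure,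
    show treeVec hT m ⁻¹' {x | x m ∈ s} = s ×ˢ Set.univ by ext; simp,
    ← Measure.prod_restrict, Measure.restrict_univ]

theorem lintegral_treeMeasure_smul [∀ e, IsProbabilityMeasure (ν e)] (m : V)
    {f : (V → ℝ) → ℝ≥0∞} (hf : Measurable f) {t : ℝ} (ht : 0 < t) :
    ∫⁻ x, f (t • x) ∂(treeMeasure hT m powerMeasure ν) =
      ENNReal.ofReal t * ∫⁻ x, f x ∂(treeMeasure hT m powerMeasure ν) := by
  have hm : Measurable fun r : ℝ => ∫⁻ w, f (treeVec hT m (r, w)) ∂(Measure.pi ν) :=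
    Measurable.lintegral_prod_right' (f := fun q => f (treeVec hT m q)) (by fun_prop)
  rw [lintegral_treeMeasure hT m (by fun_prop), lintegral_treeMeasure hT m hf,
    ← lintegral_powerMeasure_mul hm ht]
  refine lintegral_congr fun r => lintegral_congr fun w => ?_
  congr 1
  ext i
  simp [treeVec, mul_assoc]

/-- The vector with root value `a` at `m`, value `b` at its neighbour `m'`, and weights `w` on the
other edges. -/
noncomputable def twoRootVec (m m' : V) (w : T.Dart → ℝ) (a b : ℝ) (v : V) : ℝ :=
  if T.dist m' v = T.dist m v + 1 then a * edgeProd hT m w v else b * edgeProd hT m' w v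

omit [Fintype T.Dart] in
-- The edge between the roots affects the vector only through the values at its two ends. The
-- mirrored lemma gives the same function for the other root, so the two roots differ only in the
-- law of that pair of values.
theorem treeVec_update_left [DecidableEq T.Dart] {m m' : V} (h : T.Adj m m') (r u : ℝ)
    (w : T.Dart → ℝ) :
    treeVec hT m (r, Function.update w ⟨(m, m'), h⟩ u) = twoRootVec hT m m' w r (r * u) := by
  ext v
  simp only [treeVec, twoRootVec]
  split_ifs with hd
  · rw [edgeProd_update hT h hd (.inr rfl)]
  · have hd' := (dist_adj_cases hT h v).resolve_right hd
    rw [edgeProd_cons hT h hd', Function.update_self, edgeProd_update hT h.symm hd' (.inl rfl),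
      mul_assoc]

omit [Fintype T.Dart] in
theorem treeVec_update_right [DecidableEq T.Dart] {m m' : V} (h : T.Adj m m') (r u : ℝ)
    (w : T.Dart → ℝ) :
    treeVec hT m' (r, Function.update w ⟨(m', m), h.symm⟩ u) =
      twoRootVec hT m m' w (r * u) r := by
  ext v
  simp only [treeVec, twoRootVec]
  split_ifs with hd
  · rw [edgeProd_cons hT h.symm hd, Function.update_self, edgeProd_update hT h hd (.inl rfl),
      mul_assoc]
  · have hd' := (dist_adj_cases hT h v).resolve_right hd
    rw [edgeProd_update hT h.symm hd' (.inr rfl)]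

omit [Fintype T.Dart] in
theorem twoRootVec_left {m m' : V} (h : T.Adj m m') (w : T.Dart → ℝ) (a b : ℝ) :
    twoRootVec hT m m' w a b m = a := by
  have : T.dist m' m = T.dist m m + 1 := by
    rw [SimpleGraph.dist_self, zero_add, SimpleGraph.dist_eq_one_iff_adj]
    exact h.symm
  simp [twoRootVec, this]

omit [Fintype T.Dart] in
theorem twoRootVec_right {m m' : V} (w : T.Dart → ℝ) (a b : ℝ) :
    twoRootVec hT m m' w a b m' = b := by
  simp [twoRootVec]

omit [Fintype T.Dart] in
theorem measurable_twoRootVec (m m' : V) (w : T.Dart → ℝ) :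
    Measurable fun p : ℝ × ℝ => twoRootVec hT m m' w p.1 p.2 := by
  rw [measurable_pi_iff]
  intro v
  unfold twoRootVec
  split_ifs <;> fun_prop

theorem treeMeasure_restrict_adj [∀ e, IsProbabilityMeasure (ν e)]
    (hdual : ∀ e, LawDuality (ν e) (ν e.symm)) {m m' : V} (h : T.Adj m m') :
    (treeMeasure hT m powerMeasure ν).restrict {x | 0 < x m ∧ 0 < x m'} =
      (treeMeasure hT m' powerMeasure ν).restrict {x | 0 < x m ∧ 0 < x m'} := by
  classical
  have hP : MeasurableSet {x : V → ℝ | 0 < x m ∧ 0 < x m'} :=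
    (measurableSet_lt measurable_const (measurable_pi_apply m)).inter
      (measurableSet_lt measurable_const (measurable_pi_apply m'))
  ext s hs
  rw [Measure.restrict_apply hs, Measure.restrict_apply hs,
    ← lintegral_indicator_one (hs.inter hP), ← lintegral_indicator_one (hs.inter hP)]
  set φ : (V → ℝ) → ℝ≥0∞ := (s ∩ {x | 0 < x m ∧ 0 < x m'}).indicator 1 with hφ
  have hφm : Measurable φ := measurable_one.indicator (hs.inter hP)
  have hφ0 : ∀ x, ¬ (0 < x m ∧ 0 < x m') → φ x = 0 := fun x hx =>
    Set.indicator_of_notMem (fun hx' => hx hx'.2) _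
  let d : T.Dart := ⟨(m, m'), h⟩
  -- The weight of the root edge is redrawn and the frozen weights are moved outermost; for fixed
  -- `w` only the radius and that one weight remain, as the duality requires.
  have swap : ∀ n : V, ∀ e : T.Dart, ∫⁻ x, φ x ∂(treeMeasure hT n powerMeasure ν) =
      ∫⁻ w, ∫⁻ r, ∫⁻ u, φ (treeVec hT n (r, Function.update w e u)) ∂(ν e) ∂powerMeasure
        ∂(Measure.pi ν) := by
    intro n e
    rw [lintegral_treeMeasure hT n hφm]
    simp_rw [fun r : ℝ => lintegral_pi_resample ν e
      (f := fun w => φ (treeVec hT n (r, w))) (by fun_prop)]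
    refine lintegral_lintegral_swap ?_
    refine Measurable.aemeasurable ?_
    refine Measurable.lintegral_prod_right' (ν := ν e)
      (f := fun q : (ℝ × (T.Dart → ℝ)) × ℝ =>
        φ (treeVec hT n (q.1.1, Function.update q.1.2 e q.2))) ?_
    refine hφm.comp ((measurable_treeVec hT n).comp
      ((measurable_fst.comp measurable_fst).prodMk ?_))
    rw [measurable_pi_iff]
    intro i
    by_cases hi : i = e
    · subst hi; simpa using measurable_snd
    · simp only [Function.update_of_ne hi]; fun_prop
  rw [swap m d, swap m' d.symm]
  refine lintegral_congr fun w => ?_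
  have hH : Measurable fun p : ℝ × ℝ => φ (twoRootVec hT m m' w p.1 p.2) :=
    hφm.comp (measurable_twoRootVec hT m m' w)
  have key := (hdual d).lintegral_powerMeasure hH
  have l1 : ∀ᵐ r ∂powerMeasure, ∫⁻ u, φ (treeVec hT m (r, Function.update w d u)) ∂(ν d) =
      ∫⁻ u in Set.Ioi 0, φ (twoRootVec hT m m' w r (r * u)) ∂(ν d) := by
    filter_upwards [ae_powerMeasure_pos] with r hr
    rw [← lintegral_indicator measurableSet_Ioi]
    refine lintegral_congr fun u => ?_
    rw [treeVec_update_left hT h]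
    by_cases hu : 0 < u
    · rw [Set.indicator_of_mem (by exact hu)]
    · rw [Set.indicator_of_notMem (by exact hu)]
      refine hφ0 _ fun hx => hu ?_
      rw [twoRootVec_right] at hx
      exact (mul_pos_iff_of_pos_left hr).1 hx.2
  have l2 : ∀ᵐ r ∂powerMeasure,
      ∫⁻ u, φ (treeVec hT m' (r, Function.update w d.symm u)) ∂(ν d.symm) =
      ∫⁻ u in Set.Ioi 0, φ (twoRootVec hT m m' w (r * u) r) ∂(ν d.symm) := by
    filter_upwards [ae_powerMeasure_pos] with r hr
    rw [← lintegral_indicator measurableSet_Ioi]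
    refine lintegral_congr fun u => ?_
    rw [show d.symm = ⟨(m', m), h.symm⟩ from rfl, treeVec_update_right hT h]
    by_cases hu : 0 < u
    · rw [Set.indicator_of_mem (by exact hu)]
    · rw [Set.indicator_of_notMem (by exact hu)]
      refine hφ0 _ fun hx => hu ?_
      rw [twoRootVec_left hT h] at hx
      exact (mul_pos_iff_of_pos_left hr).1 hx.1
  rw [lintegral_congr_ae l1, lintegral_congr_ae l2]
  exact key

theorem restrict_eq_restrict_of_ae_imp {α : Type*} [MeasurableSpace α] {μ : Measure α}
    {s t : Set α} (hst : t ⊆ s) (h : ∀ᵐ x ∂μ, x ∈ s → x ∈ t) :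
    μ.restrict s = μ.restrict t := by
  refine Measure.restrict_congr_set ?_
  filter_upwards [h] with x hx
  exact propext ⟨hx, fun hx' => hst hx'⟩

/-- Tree measures with different roots agree where both roots are positive. -/
theorem treeMeasure_restrict_pos [∀ e, IsProbabilityMeasure (ν e)]
    (hν : ∀ e, ∀ᵐ u ∂(ν e), 0 ≤ u) (hdual : ∀ e, LawDuality (ν e) (ν e.symm)) (m m' : V) :
    (treeMeasure hT m powerMeasure ν).restrict {x | 0 < x m ∧ 0 < x m'} =
      (treeMeasure hT m' powerMeasure ν).restrict {x | 0 < x m ∧ 0 < x m'} := by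
  have hlt : ∀ v : V, MeasurableSet {x : V → ℝ | 0 < x v} := fun v =>
    measurableSet_lt measurable_const (measurable_pi_apply v)
  induction m' using outward_induction hT (m := m) with
  | base => rfl
  | step e he ih =>
    have he' : T.dist m e.snd = T.dist m e.fst + 1 := he
    have hadj := treeMeasure_restrict_adj hT hdual e.adj
    -- A zero factor kills everything farther along a path, so positivity at both ends forces
    -- positivity at the tail of the last edge, seen from either root. On this smaller set the
    -- induction hypothesis and the adjacent case chain together.
    have i1 : ∀ᵐ x ∂(treeMeasure hT m powerMeasure ν), 0 < x e.snd → 0 < x e.fst := by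
      refine ae_treeMeasure_of hT hν ae_powerMeasure_pos m ?_ fun q h1 h2 h3 => ?_
      · exact (hlt _).imp (hlt _)
      · rw [treeVec_snd hT he] at h3
        exact pos_of_mul_pos_left h3 (h2 e)
    have i2 : ∀ᵐ x ∂(treeMeasure hT e.snd powerMeasure ν), 0 < x m → 0 < x e.fst := by
      refine ae_treeMeasure_of hT hν ae_powerMeasure_pos e.snd ?_ fun q h1 h2 h3 => ?_
      · exact (hlt _).imp (hlt _)
      · have hd : T.dist e.snd m = T.dist e.fst m + 1 := by
          rw [SimpleGraph.dist_comm, he', SimpleGraph.dist_comm]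
        have hself : T.dist e.snd e.fst = T.dist e.fst e.fst + 1 := by
          rw [SimpleGraph.dist_self, zero_add, SimpleGraph.dist_eq_one_iff_adj]
          exact e.adj.symm
        simp only [treeVec] at h3 ⊢
        rw [edgeProd_cons hT e.adj.symm hd, ← mul_assoc] at h3
        rw [edgeProd_cons hT e.adj.symm hself, edgeProd_self, mul_one]
        exact pos_of_mul_pos_left h3 (edgeProd_nonneg hT h2 _ _)
    let P : Set (V → ℝ) := {x | 0 < x m ∧ 0 < x e.snd}
    let P3 : Set (V → ℝ) := {x | 0 < x e.fst} ∩ P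
    have hP : MeasurableSet P := (hlt m).inter (hlt e.snd)
    have r1 : (treeMeasure hT m powerMeasure ν).restrict P =
        (treeMeasure hT m powerMeasure ν).restrict P3 :=
      restrict_eq_restrict_of_ae_imp Set.inter_subset_right
        (i1.mono fun x hx hxP => ⟨hx hxP.2, hxP⟩)
    have r2 : (treeMeasure hT e.snd powerMeasure ν).restrict P =
        (treeMeasure hT e.snd powerMeasure ν).restrict P3 :=
      restrict_eq_restrict_of_ae_imp Set.inter_subset_right
        (i2.mono fun x hx hxP => ⟨hx hxP.1, hxP⟩)
    change Measure.restrict _ P = Measure.restrict _ P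
    rw [r1, r2]
    have hP3 : MeasurableSet P3 := (hlt _).inter hP
    have s1 : P3 ⊆ {x | 0 < x m ∧ 0 < x e.fst} := fun x hx => ⟨hx.2.1, hx.1⟩
    have s2 : P3 ⊆ {x | 0 < x e.fst ∧ 0 < x e.snd} := fun x hx => ⟨hx.1, hx.2.2⟩
    calc (treeMeasure hT m powerMeasure ν).restrict P3
        = ((treeMeasure hT m powerMeasure ν).restrict {x | 0 < x m ∧ 0 < x e.fst}).restrict P3 := by
          rw [Measure.restrict_restrict hP3,
            Set.inter_eq_left.2 s1]
      _ = (treeMeasure hT e.fst powerMeasure ν).restrict P3 := by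
          rw [ih, Measure.restrict_restrict hP3,
            Set.inter_eq_left.2 s1]
      _ = ((treeMeasure hT e.fst powerMeasure ν).restrict
            {x | 0 < x e.fst ∧ 0 < x e.snd}).restrict P3 := by
          rw [Measure.restrict_restrict hP3,
            Set.inter_eq_left.2 s2]
      _ = (treeMeasure hT e.snd powerMeasure ν).restrict P3 := by
          rw [hadj, Measure.restrict_restrict hP3,
            Set.inter_eq_left.2 s2]

end TreeMeasure

/-! ### Gluing measures along overlaps. -/

section Glue

/-- Finitely many measures that agree on overlaps are restrictions of a common measure. -/
theorem exists_measure_restrict_eq {α ι : Type*} [MeasurableSpace α] [Fintype ι]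
    {P : ι → Set α} (hP : ∀ i, MeasurableSet (P i)) {Λ : ι → Measure α}
    (hself : ∀ i, (Λ i).restrict (P i) = Λ i)
    (hcomp : ∀ i j, (Λ i).restrict (P j) = (Λ j).restrict (P i)) :
    ∃ M : Measure α, (∀ i, M.restrict (P i) = Λ i) ∧ ∀ᵐ x ∂M, x ∈ ⋃ i, P i := by
  -- A point lying in `N` of the sets is charged `N` times by the sum of the measures; the weight `1
  -- / N` corrects this.
  let N : α → ℝ≥0∞ := fun x => ∑ i, (P i).indicator 1 x
  have hN : Measurable N := by
    refine Finset.measurable_sum _ fun i _ => ?_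
    exact measurable_one.indicator (hP i)
  have hNi : Measurable fun x => (N x)⁻¹ := hN.inv
  have hNtop : ∀ x, N x ≠ ∞ := by
    intro x
    refine ENNReal.sum_ne_top.2 fun i _ => ?_
    by_cases h : x ∈ P i <;> simp [h]
  have hN0 : ∀ i, ∀ x ∈ P i, N x ≠ 0 := by
    intro i x hx h
    have := (Finset.sum_eq_zero_iff.1 h) i (Finset.mem_univ i)
    rw [Set.indicator_of_mem hx] at this
    exact one_ne_zero this
  have hself' : ∀ i, ∀ᵐ x ∂(Λ i), x ∈ P i := by
    intro i
    rw [← hself i]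
    exact ae_restrict_mem (hP i)
  refine ⟨∑ i, (Λ i).withDensity fun x => (N x)⁻¹, fun k => ?_, ?_⟩
  · ext s hs
    rw [Measure.restrict_apply hs, Measure.finsetSum_apply]
    -- Compatibility trades `Λ i` on `P k` for `Λ k` on `P i`, so all terms become integrals against
    -- `Λ k`.
    have h1 : ∀ i, (Λ i).withDensity (fun x => (N x)⁻¹) (s ∩ P k) =
        ∫⁻ x in s, (P i).indicator 1 x * (N x)⁻¹ ∂(Λ k) := by
      intro i
      rw [withDensity_apply _ (hs.inter (hP k)), ← Measure.restrict_restrict hs, hcomp i k,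
        Measure.restrict_restrict hs, Set.inter_comm, ← Measure.restrict_restrict (hP i),
        ← lintegral_indicator (hP i)]
      refine lintegral_congr fun x => ?_
      by_cases h : x ∈ P i <;> simp [h]
    simp_rw [h1]
    rw [← lintegral_finsetSum]
    · simp_rw [← Finset.sum_mul]
      rw [← setLIntegral_one]
      refine lintegral_congr_ae ?_
      filter_upwards [ae_restrict_of_ae (hself' k)] with x hx
      exact ENNReal.mul_inv_cancel (hN0 k x hx) (hNtop x)
    · intro i _
      exact (measurable_one.indicator (hP i)).mul hNi
  · rw [ae_iff, Measure.finsetSum_apply]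
    refine Finset.sum_eq_zero fun i _ => ?_
    refine withDensity_absolutelyContinuous _ _ ?_
    rw [← ae_iff]
    filter_upwards [hself' i] with x hx using Set.mem_iUnion_of_mem i hx

theorem measure_eq_of_restrict_eq {α ι : Type*} [MeasurableSpace α] [Countable ι]
    {P : ι → Set α} {M M' : Measure α} (h : ∀ i, M.restrict (P i) = M'.restrict (P i))
    (hM : ∀ᵐ x ∂M, x ∈ ⋃ i, P i) (hM' : ∀ᵐ x ∂M', x ∈ ⋃ i, P i) : M = M' := by
  rw [← Measure.restrict_eq_self_of_ae_mem hM, ← Measure.restrict_eq_self_of_ae_mem hM']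
  exact Measure.restrict_iUnion_congr.2 h

end Glue

/-! ### Multivariate Pareto laws and their exceedance laws. -/

section Pareto

variable {V : Type*} [Fintype V]

theorem measurableSet_one_lt (m : V) : MeasurableSet {x : V → ℝ | 1 < x m} :=
  measurableSet_lt measurable_const (measurable_pi_apply m)

theorem measurableSet_pos (m : V) : MeasurableSet {x : V → ℝ | 0 < x m} :=
  measurableSet_lt measurable_const (measurable_pi_apply m)

theorem measurableSet_paretoSupport : MeasurableSet (paretoSupport V) := by
  have : paretoSupport V = (⋂ i, {x : V → ℝ | 0 ≤ x i}) ∩ ⋃ i, {x | 1 < x i} := by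
    ext x; simp [paretoSupport]
  rw [this]
  exact (MeasurableSet.iInter fun i => measurableSet_le measurable_const (measurable_pi_apply i)).inter
    (MeasurableSet.iUnion measurableSet_one_lt)

theorem image_smul_eq_preimage {t : ℝ} (ht : 0 < t) (A : Set (V → ℝ)) :
    (fun x : V → ℝ => t • x) '' A = (fun x => t⁻¹ • x) ⁻¹' A := by
  ext x
  constructor
  · rintro ⟨y, hy, rfl⟩
    simpa [smul_smul, ht.ne'] using hy
  · intro hx
    exact ⟨t⁻¹ • x, hx, by simp [smul_smul, ht.ne']⟩

theorem IsMultivariatePareto.ae_mem_iUnion {μ : Measure (V → ℝ)} (h : IsMultivariatePareto μ) :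
    ∀ᵐ x ∂μ, x ∈ ⋃ i, {x : V → ℝ | 1 < x i} := by
  filter_upwards [h.ae_mem_support] with x hx
  obtain ⟨i, hi⟩ := hx.2
  exact Set.mem_iUnion_of_mem i hi

/-- The margins are equal, so if one exceedance event were null all would be, yet they cover the
support. -/
theorem IsMultivariatePareto.measure_ne_zero {μ : Measure (V → ℝ)} (h : IsMultivariatePareto μ)
    (m : V) : μ {x | 1 < x m} ≠ 0 := by
  intro h0
  have := h.isProbabilityMeasure
  have h1 : μ (⋃ i, {x : V → ℝ | 1 < x i}) = 0 :=
    measure_iUnion_null fun i => by rw [h.margins i m, h0]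
  have h2 := measure_eq_zero_iff_ae_notMem.1 h1
  have h3 : ∀ᵐ _ ∂μ, False := by
    filter_upwards [h2, h.ae_mem_iUnion] with x hx hx' using hx hx'
  simp [ae_iff] at h3

theorem IsMultivariatePareto.restrict_eq {μ : Measure (V → ℝ)} (h : IsMultivariatePareto μ)
    (m : V) : μ.restrict {x | 1 < x m} = μ {x | 1 < x m} • exceedanceLaw μ m := by
  have := h.isProbabilityMeasure
  rw [exceedanceLaw, ProbabilityTheory.cond, smul_smul,
    ENNReal.mul_inv_cancel (h.measure_ne_zero m) (measure_ne_top _ _), one_smul]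

/-- A multivariate Pareto distribution is determined by its conditional laws given exceedances. -/
theorem IsMultivariatePareto.eq_of_exceedanceLaw_eq {μ μ' : Measure (V → ℝ)}
    (h : IsMultivariatePareto μ) (h' : IsMultivariatePareto μ')
    (he : ∀ m, exceedanceLaw μ m = exceedanceLaw μ' m) : μ = μ' := by
  have := h.isProbabilityMeasure
  have := h'.isProbabilityMeasure
  obtain ⟨m⟩ : Nonempty V := by
    obtain ⟨x, hx⟩ := h.ae_mem_support.exists
    exact ⟨hx.2.choose⟩
  have hne := h.measure_ne_zero m
  have hne' := h'.measure_ne_zero m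
  -- After division by the common margin, the restriction to each `{x_i > 1}` is an exceedance law.
  -- The two constants are compared afterwards through total mass one.
  have hsm : (μ {x | 1 < x m})⁻¹ • μ = (μ' {x | 1 < x m})⁻¹ • μ' := by
    refine measure_eq_of_restrict_eq (P := fun i => {x : V → ℝ | 1 < x i}) (fun i => ?_)
      (Measure.ae_smul_measure h.ae_mem_iUnion _) (Measure.ae_smul_measure h'.ae_mem_iUnion _)
    rw [Measure.restrict_smul, Measure.restrict_smul, h.restrict_eq, h'.restrict_eq,
      h.margins i m, h'.margins i m, he i, smul_smul, smul_smul,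
      ENNReal.inv_mul_cancel hne (measure_ne_top _ _),
      ENNReal.inv_mul_cancel hne' (measure_ne_top _ _)]
  have hu := DFunLike.congr_fun hsm Set.univ
  simp only [Measure.smul_apply, measure_univ, smul_eq_mul, mul_one] at hu
  have hcancel := ENNReal.mul_inv_cancel hne (measure_ne_top _ _)
  calc μ = μ {x | 1 < x m} • (μ {x | 1 < x m})⁻¹ • μ := by rw [smul_smul, hcancel, one_smul]
    _ = μ' := by rw [hsm, ← hu, smul_smul, hcancel, one_smul]

/-- A homogeneous measure whose restrictions to `{x_m > 1}` are probability measures, conditioned on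
`𝓛`, is a multivariate Pareto distribution. -/
theorem isMultivariatePareto_cond [Nonempty V] {M : Measure (V → ℝ)} {κ : V → Measure (V → ℝ)}
    [∀ m, IsProbabilityMeasure (κ m)] (hnonneg : ∀ᵐ x ∂M, ∀ i, 0 ≤ x i)
    (hhom : ∀ t : ℝ, 0 < t → M.map (fun x => t • x) = ENNReal.ofReal t • M)
    (hκ : ∀ m, M.restrict {x | 1 < x m} = κ m) :
    IsMultivariatePareto (cond M (paretoSupport V)) ∧
      ∀ m, exceedanceLaw (cond M (paretoSupport V)) m = κ m := by
  have hL := measurableSet_paretoSupport (V := V)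
  have hM1 : ∀ m, M {x | 1 < x m} = 1 := fun m => by
    rw [← Measure.restrict_apply_univ, hκ m, measure_univ]
  have hML : ∀ m, M (paretoSupport V ∩ {x | 1 < x m}) = 1 := fun m => by
    rw [← hM1 m]
    refine measure_congr ?_
    filter_upwards [hnonneg] with x hx
    exact propext ⟨fun h => h.2, fun h => ⟨⟨hx, m, h⟩, h⟩⟩
  have hL0 : M (paretoSupport V) ≠ 0 := by
    intro h0
    have := hML (Classical.arbitrary V)
    rw [measure_mono_null Set.inter_subset_left h0] at this
    exact zero_ne_one this
  have hLtop : M (paretoSupport V) ≠ ∞ := by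
    -- `M` itself may be infinite, but `𝓛` is covered by finitely many sets of mass one.
    have h1 : M (⋃ i, {x : V → ℝ | 1 < x i}) ≠ ∞ := by
      refine ((measure_iUnion_fintype_le M _).trans_lt ?_).ne
      simp [hM1]
    refine ((measure_mono fun x hx => ?_).trans_lt h1.lt_top).ne
    obtain ⟨i, hi⟩ := hx.2
    exact Set.mem_iUnion_of_mem i hi
  set c := (M (paretoSupport V))⁻¹ with hc
  have hmargin : ∀ m, cond M (paretoSupport V) {x | 1 < x m} = c := fun m => by
    rw [cond_apply hL, hML m, mul_one]
  refine ⟨⟨cond_isProbabilityMeasure_of_finite hL0 hLtop, ?_, ?_, fun i j => ?_⟩, fun m => ?_⟩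
  · exact ae_cond_mem hL
  · intro t ht A hA hAL
    have ht0 : 0 < t := by linarith
    have hsub : (fun x : V → ℝ => t • x) '' A ⊆ paretoSupport V := by
      rintro _ ⟨x, hx, rfl⟩
      obtain ⟨h1, i, h2⟩ := hAL hx
      refine ⟨fun j => mul_nonneg ht0.le (h1 j), i, ?_⟩
      change 1 < t * x i
      nlinarith
    rw [cond_apply hL, cond_apply hL, Set.inter_eq_right.2 hsub, Set.inter_eq_right.2 hAL,
      image_smul_eq_preimage ht0, ← Measure.map_apply (by fun_prop) hA,
      hhom _ (inv_pos.2 ht0), Measure.smul_apply, smul_eq_mul, ENNReal.ofReal_inv_of_pos ht0]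
    ring
  · rw [hmargin, hmargin]
  · rw [exceedanceLaw, ProbabilityTheory.cond, hmargin, ProbabilityTheory.cond,
      Measure.restrict_smul, Measure.restrict_restrict (measurableSet_one_lt m), smul_smul,
      ← hc, ENNReal.inv_mul_cancel (ENNReal.inv_ne_zero.2 hLtop) (ENNReal.inv_ne_top.2 hL0),
      one_smul, ← hκ m]
    refine Measure.restrict_congr_set ?_
    filter_upwards [hnonneg] with x hx
    exact propext ⟨fun h => h.1, fun h => ⟨h, ⟨hx, m, h⟩⟩⟩

end Pareto

/-! ### Construction of the Pareto law from the edge laws. -/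

section TreeConstruction

variable {V : Type*} [Fintype V] {T : SimpleGraph V} [Fintype T.Dart] (hT : T.IsTree)
  {ν : T.Dart → Measure ℝ} [∀ e, IsProbabilityMeasure (ν e)]

instance {ρ : Measure ℝ} [IsProbabilityMeasure ρ] (m : V) :
    IsProbabilityMeasure (treeMeasure hT m ρ ν) :=
  Measure.isProbabilityMeasure_map (by fun_prop)

theorem treeMeasure_powerMeasure_restrict_one_lt (m : V) :
    (treeMeasure hT m powerMeasure ν).restrict {x | 1 < x m} = treeMeasure hT m stdPareto ν := by
  rw [stdPareto_eq_restrict, ← treeMeasure_restrict_root hT m measurableSet_Ioi]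
  rfl

theorem map_smul_treeMeasure (m : V) {t : ℝ} (ht : 0 < t) :
    (treeMeasure hT m powerMeasure ν).map (fun x => t • x) =
      ENNReal.ofReal t • treeMeasure hT m powerMeasure ν := by
  refine Measure.ext_of_lintegral _ fun f hf => ?_
  rw [lintegral_map hf (by fun_prop), lintegral_treeMeasure_smul hT m hf ht,
    lintegral_smul_measure, smul_eq_mul]

theorem exists_multivariatePareto (hν : ∀ e, ∀ᵐ u ∂(ν e), 0 ≤ u)
    (hdual : ∀ e, LawDuality (ν e) (ν e.symm)) :
    ∃ μ : Measure (V → ℝ), IsMultivariatePareto μ ∧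
      ∀ m, exceedanceLaw μ m = treeMeasure hT m stdPareto ν := by
  have hpos : ∀ m, (treeMeasure hT m powerMeasure ν).restrict {x | 0 < x m} =
      treeMeasure hT m powerMeasure ν := fun m =>
    Measure.restrict_eq_self_of_ae_mem
      (ae_treeMeasure_of hT hν ae_powerMeasure_pos m (measurableSet_pos m)
        fun q h1 _ => by simpa using h1)
  obtain ⟨M, hM, hMmem⟩ := exists_measure_restrict_eq (P := fun m : V => {x : V → ℝ | 0 < x m})
    measurableSet_pos (Λ := fun m => treeMeasure hT m powerMeasure ν) hpos (fun m m' => by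
      have h := treeMeasure_restrict_pos hT hν hdual m m'
      have e : {x : V → ℝ | 0 < x m ∧ 0 < x m'} = {x | 0 < x m'} ∩ {x | 0 < x m} := by
        ext; simp [and_comm]
      calc _ = ((treeMeasure hT m powerMeasure ν).restrict {x | 0 < x m}).restrict
            {x | 0 < x m'} := by rw [hpos]
        _ = (treeMeasure hT m' powerMeasure ν).restrict ({x | 0 < x m} ∩ {x | 0 < x m'}) := by
          rw [Measure.restrict_restrict (measurableSet_pos m'), ← e, h, e, Set.inter_comm]
        _ = _ := by rw [← Measure.restrict_restrict (measurableSet_pos m), hpos])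
  have : Nonempty V := hT.connected.nonempty
  have hnn : ∀ m : V, ∀ᵐ x ∂(treeMeasure hT m powerMeasure ν), ∀ i, 0 ≤ x i := fun m =>
    ae_treeMeasure_of hT hν ae_powerMeasure_pos m
      (by
        rw [Set.ofPred_forall]
        exact MeasurableSet.iInter fun i => measurableSet_le measurable_const
          (measurable_pi_apply i))
      fun q h1 h2 i => treeVec_nonneg hT h1.le h2 m i
  refine ⟨_, isMultivariatePareto_cond (M := M) (κ := fun m => treeMeasure hT m stdPareto ν)
    ?_ ?_ ?_⟩
  · have hU : M.restrict (⋃ m : V, {x : V → ℝ | 0 < x m}) = M :=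
      Measure.restrict_eq_self_of_ae_mem hMmem
    rw [← hU, ae_restrict_iUnion_iff]
    intro m
    rw [hM m]
    exact hnn m
  · intro t ht
    -- Each `{x_m > 0}` is invariant under positive scaling, so the homogeneity of the glued measure
    -- is inherited piece by piece.
    refine measure_eq_of_restrict_eq (P := fun m : V => {x : V → ℝ | 0 < x m}) (fun m => ?_) ?_
      (Measure.ae_smul_measure hMmem _)
    · rw [Measure.restrict_map (by fun_prop) (measurableSet_pos m), Measure.restrict_smul, hM,
        ← map_smul_treeMeasure hT m ht, ← hM m]
      congr 2
      ext x
      simp [mul_pos_iff_of_pos_left ht]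
    · refine (ae_map_iff (p := fun x => x ∈ ⋃ i, {x : V → ℝ | 0 < x i}) (by fun_prop)
        (MeasurableSet.iUnion measurableSet_pos)).2 ?_
      filter_upwards [hMmem] with x hx
      obtain ⟨i, hi⟩ := Set.mem_iUnion.1 hx
      exact Set.mem_iUnion_of_mem i (mul_pos ht hi)
  · intro m
    rw [← treeMeasure_powerMeasure_restrict_one_lt, ← hM m,
      Measure.restrict_restrict (measurableSet_one_lt m), Set.inter_eq_left.2]
    exact fun x (hx : 1 < x m) => lt_trans zero_lt_one hx

end TreeConstruction

/-! ### Independence of an unused coordinate. -/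

section Independence

variable {ι α : Type*} [Fintype ι] [DecidableEq ι] [MeasurableSpace α]

/-- Redrawing coordinate `d` leaves both the law and the value of `f` unchanged. -/
theorem map_prodMk_eval_of_update {ρ : Measure ℝ} [SFinite ρ] {ν : ι → Measure ℝ}
    [∀ i, IsProbabilityMeasure (ν i)] (d : ι) {f : ℝ × (ι → ℝ) → α} (hf : Measurable f)
    (hupd : ∀ r w u, f (r, Function.update w d u) = f (r, w)) :
    (ρ.prod (Measure.pi ν)).map (fun q => (f q, q.2 d)) =
      ((ρ.prod (Measure.pi ν)).map f).prod (ν d) := by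
  refine Measure.ext_of_lintegral _ fun g hg => ?_
  have hg' : Measurable fun q : ℝ × (ι → ℝ) => ∫⁻ u, g (f q, u) ∂(ν d) :=
    Measurable.lintegral_prod_right' (f := fun q : (ℝ × (ι → ℝ)) × ℝ => g (f q.1, q.2))
      (by fun_prop)
  rw [lintegral_map hg (by fun_prop), lintegral_prod _ (by fun_prop),
    lintegral_prod _ hg.aemeasurable, lintegral_map hg.lintegral_prod_right' hf,
    lintegral_prod _ hg'.aemeasurable]
  refine lintegral_congr fun r => ?_
  rw [lintegral_pi_resample ν d (f := fun w => g (f (r, w), w d)) (by fun_prop)]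
  simp_rw [hupd, Function.update_self]

theorem indepFun_eval_of_update {ρ : Measure ℝ} [IsProbabilityMeasure ρ] {ν : ι → Measure ℝ}
    [∀ i, IsProbabilityMeasure (ν i)] (d : ι) {f : ℝ × (ι → ℝ) → α} (hf : Measurable f)
    (hupd : ∀ r w u, f (r, Function.update w d u) = f (r, w)) :
    IndepFun f (fun q => q.2 d) (ρ.prod (Measure.pi ν)) := by
  rw [indepFun_iff_map_prod_eq_prod_map_map hf.aemeasurable (by fun_prop),
    map_prodMk_eval_of_update d hf hupd]
  congr 1
  rw [show (fun q : ℝ × (ι → ℝ) => q.2 d) = Function.eval d ∘ Prod.snd from rfl,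
    ← Measure.map_map (measurable_pi_apply d) measurable_snd, Measure.map_snd_prod, measure_univ,
    one_smul, (measurePreserving_eval ν d).map_eq]

end Independence

/-! ### The Markov property of tree vectors. -/

section Markov

variable {V : Type*} {T : SimpleGraph V} (hT : T.IsTree)

/-- Subvectors on `S` are encoded as vectors on `V` extended by zero, so that the type stays fixed
while `S` grows. -/
theorem measurable_indicator_pi (S : Set V) : Measurable fun x : V → ℝ => S.indicator x := by
  classical
  rw [measurable_pi_iff]
  intro v
  by_cases hv : v ∈ S
  · simpa [hv] using measurable_pi_apply v
  · simp [hv]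

theorem IsRootedSubtree.treeVec_update [DecidableEq T.Dart] {m : V} {S : Set V}
    (hS : IsRootedSubtree T m S) {e : T.Dart} (he : e.snd ∉ S) {v : V} (hv : v ∈ S) (r u : ℝ)
    (w : T.Dart → ℝ) :
    treeVec hT m (r, Function.update w e u) v = treeVec hT m (r, w) v := by
  simp only [treeVec]
  congr 1
  refine hS.edgeProd_congr hT hv fun d _ hd => Function.update_of_ne ?_ _ _
  rintro rfl
  exact he hd

theorem IsRootedSubtree.indicator_treeVec_update [DecidableEq T.Dart] {m : V} {S A : Set V}
    (hS : IsRootedSubtree T m S) {e : T.Dart} (he : e.snd ∉ S) (hA : A ⊆ S) (r u : ℝ)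
    (w : T.Dart → ℝ) :
    A.indicator (treeVec hT m (r, Function.update w e u)) =
      A.indicator (treeVec hT m (r, w)) := by
  ext v
  by_cases hv : v ∈ A
  · simp [hv, hS.treeVec_update hT he (hA hv)]
  · simp [hv]

theorem indicator_eq_update [DecidableEq V] {D : Set V} {j : V} (hj : j ∈ D) (x : V → ℝ) :
    D.indicator x = Function.update ((D \ {j}).indicator x) j (x j) := by
  ext v
  by_cases hv : v = j
  · subst hv; simp [hj]
  · rw [Function.update_of_ne hv]
    by_cases hD : v ∈ D
    · rw [Set.indicator_of_mem hD, Set.indicator_of_mem (show v ∈ D \ {j} from ⟨hD, hv⟩)]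
    · rw [Set.indicator_of_notMem hD, Set.indicator_of_notMem fun h => hD h.1]

theorem measurable_update_apply [DecidableEq V] {α : Type*} [MeasurableSpace α] {a : α → V → ℝ}
    (ha : Measurable a) (j : V) {b : α → ℝ} (hb : Measurable b) :
    Measurable fun x => Function.update (a x) j (b x) := by
  rw [measurable_pi_iff]
  intro v
  by_cases hv : v = j
  · subst hv; simpa using hb
  · simp only [Function.update_of_ne hv]; fun_prop

/-- Reads off the parent's value without a case distinction on which part contains it. -/
theorem indicator_add_indicator_apply {A B : Set V} (hAB : Disjoint A B) {i : V} (hi : i ∈ A ∪ B)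
    (x : V → ℝ) : A.indicator x i + B.indicator x i = x i := by
  rcases hi with h | h
  · simp [h, Set.disjoint_left.1 hAB h]
  · simp [h, Set.disjoint_right.1 hAB h]

variable [Finite V] [Fintype T.Dart] {ρ : Measure ℝ} [IsProbabilityMeasure ρ]
  {ν : T.Dart → Measure ℝ} [∀ e, IsProbabilityMeasure (ν e)]

/-- The Markov property for a partition of `S` without edges between the outer parts. -/
def PartitionMarkov (hT : T.IsTree) (m : V) (P : Measure (ℝ × (T.Dart → ℝ))) (S : Set V) : Prop :=
  ∀ A B C : Set V, A ∪ B ∪ C = S → Disjoint A B → Disjoint B C → Disjoint A C →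
    (∀ a ∈ A, ∀ c ∈ C, ¬ T.Adj a c) →
    CondIndepVar (fun q => A.indicator (treeVec hT m q)) (fun q => C.indicator (treeVec hT m q))
      (fun q => B.indicator (treeVec hT m q)) P

theorem measurable_indicator_treeVec (m : V) (A : Set V) :
    Measurable fun q => A.indicator (treeVec hT m q) :=
  (measurable_indicator_pi A).comp (measurable_treeVec hT m)

theorem IsRootedSubtree.indepFun [DecidableEq T.Dart] {m : V} {S A B C : Set V}
    (hS : IsRootedSubtree T m S) {e : T.Dart} (he : e.snd ∉ S) (hA : A ⊆ S) (hB : B ⊆ S)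
    (hC : C ⊆ S) :
    IndepFun (fun q => (A.indicator (treeVec hT m q), B.indicator (treeVec hT m q),
      C.indicator (treeVec hT m q))) (fun q => q.2 e) (ρ.prod (Measure.pi ν)) := by
  refine indepFun_eval_of_update e ((measurable_indicator_treeVec hT m A).prodMk
    ((measurable_indicator_treeVec hT m B).prodMk (measurable_indicator_treeVec hT m C)))
    fun r w u => ?_
  rw [hS.indicator_treeVec_update hT he hA, hS.indicator_treeVec_update hT he hB,
    hS.indicator_treeVec_update hT he hC]

/-- The parent of the new leaf lies in `A` or `B`, as no edge joins `A` to `C`. The new coordinate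
is therefore a function of the old `A` and `B` parts and a fresh weight, which can be adjoined to
the old `A` part. -/
theorem PartitionMarkov.insert_left {m : V} {S : Set V} (hS : IsRootedSubtree T m S)
    {e : T.Dart} (he : e ∈ outwardEdges T m) (hi : e.fst ∈ S) (hj : e.snd ∉ S)
    (H : PartitionMarkov hT m (ρ.prod (Measure.pi ν)) S) {A B C : Set V}
    (hU : A ∪ B ∪ C = insert e.snd S) (hAB : Disjoint A B) (hBC : Disjoint B C)
    (hAC : Disjoint A C) (hadj : ∀ a ∈ A, ∀ c ∈ C, ¬ T.Adj a c) (hjA : e.snd ∈ A) :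
    CondIndepVar (fun q => A.indicator (treeVec hT m q)) (fun q => C.indicator (treeVec hT m q))
      (fun q => B.indicator (treeVec hT m q)) (ρ.prod (Measure.pi ν)) := by
  classical
  have hjB : e.snd ∉ B := Set.disjoint_left.1 hAB hjA
  have hjC : e.snd ∉ C := Set.disjoint_left.1 hAC hjA
  have hU0 : A \ {e.snd} ∪ B ∪ C = S := by
    ext v
    have hv := Set.ext_iff.1 hU v
    simp only [Set.mem_union, Set.mem_insert_iff] at hv
    simp only [Set.mem_union, Set.mem_sdiff, Set.mem_singleton_iff]
    by_cases hvj : v = e.snd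
    · subst hvj; tauto
    · tauto
  have hA0 : A \ {e.snd} ⊆ S := by
    rw [← hU0]; exact fun v hv => .inl (.inl hv)
  have hB0 : B ⊆ S := by
    rw [← hU0]; exact fun v hv => .inl (.inr hv)
  have hC0 : C ⊆ S := by
    rw [← hU0]; exact fun v hv => .inr hv
  have hAB0 : Disjoint (A \ {e.snd}) B := hAB.mono_left Set.sdiff_subset
  have hiAB : e.fst ∈ A \ {e.snd} ∪ B := by
    have h := hi
    rw [← hU0] at h
    exact h.resolve_right fun hc => hadj _ hjA _ hc e.adj.symm
  have mA := measurable_indicator_treeVec hT m (A \ {e.snd})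
  have mA' := measurable_indicator_treeVec hT m A
  have mB := measurable_indicator_treeVec hT m B
  have mC := measurable_indicator_treeVec hT m C
  have mW : Measurable fun q : ℝ × (T.Dart → ℝ) => q.2 e := by fun_prop
  have h1 := (H _ B C hU0 hAB0 hBC (hAC.mono_left Set.sdiff_subset)
    fun a ha c hc => hadj a ha.1 c hc).symm mA mC mB
  have h2 := h1.prodMk_of_indepFun mC mA mB mW (hS.indepFun hT hj hC0 hA0 hB0)
  have h3 := h2.comp (mA.prodMk mW) mB (f := id) measurable_id
    (g := fun p => Function.update p.1.1 e.snd ((p.1.1 e.fst + p.2 e.fst) * p.1.2))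
    (measurable_update_apply (by fun_prop) _ (by fun_prop)) (k := Prod.snd) measurable_snd
    (l := id) measurable_id fun _ => rfl
  refine CondIndepVar.symm ?_ mC mA' mB
  convert! h3 using 2 with q
  rw [indicator_eq_update hjA]
  simp only
  rw [indicator_add_indicator_apply hAB0 hiAB, treeVec_snd hT he]

/-- Weak union: the fresh weight joins the `C` part, and the new coordinate, a function of that
enlarged part and the old `B` part, moves into the conditioning. This needs the parent outside `A`.
-/
theorem PartitionMarkov.insert_middle {m : V} {S : Set V} (hS : IsRootedSubtree T m S)
    {e : T.Dart} (he : e ∈ outwardEdges T m) (hj : e.snd ∉ S)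
    (H : PartitionMarkov hT m (ρ.prod (Measure.pi ν)) S) {A B C : Set V}
    (hU : A ∪ B ∪ C = insert e.snd S) (hAB : Disjoint A B) (hBC : Disjoint B C)
    (hAC : Disjoint A C) (hadj : ∀ a ∈ A, ∀ c ∈ C, ¬ T.Adj a c) (hjB : e.snd ∈ B)
    (hiCB : e.fst ∈ C ∪ B) :
    CondIndepVar (fun q => A.indicator (treeVec hT m q)) (fun q => C.indicator (treeVec hT m q))
      (fun q => B.indicator (treeVec hT m q)) (ρ.prod (Measure.pi ν)) := by
  classical
  have hjA : e.snd ∉ A := Set.disjoint_right.1 hAB hjB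
  have hjC : e.snd ∉ C := Set.disjoint_left.1 hBC hjB
  have hU0 : A ∪ B \ {e.snd} ∪ C = S := by
    ext v
    have hv := Set.ext_iff.1 hU v
    simp only [Set.mem_union, Set.mem_insert_iff] at hv
    simp only [Set.mem_union, Set.mem_sdiff, Set.mem_singleton_iff]
    by_cases hvj : v = e.snd
    · subst hvj; tauto
    · tauto
  have hA0 : A ⊆ S := by
    rw [← hU0]; exact fun v hv => .inl (.inl hv)
  have hB0 : B \ {e.snd} ⊆ S := by
    rw [← hU0]; exact fun v hv => .inl (.inr hv)
  have hC0 : C ⊆ S := by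
    rw [← hU0]; exact fun v hv => .inr hv
  have hBC0 : Disjoint (B \ {e.snd}) C := hBC.mono_left Set.sdiff_subset
  have hiCB0 : e.fst ∈ C ∪ B \ {e.snd} :=
    hiCB.imp_right fun h => ⟨h, fun h' => e.adj.ne h'⟩
  have mA := measurable_indicator_treeVec hT m A
  have mB := measurable_indicator_treeVec hT m (B \ {e.snd})
  have mC := measurable_indicator_treeVec hT m C
  have mW : Measurable fun q : ℝ × (T.Dart → ℝ) => q.2 e := by fun_prop
  have h1 := H A _ C hU0 (hAB.mono_right Set.sdiff_subset) hBC0 hAC hadj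
  have h2 := h1.prodMk_of_indepFun mA mC mB mW (hS.indepFun hT hj hA0 hC0 hB0)
  have h3 := h2.comp (mC.prodMk mW) mB (f := id) measurable_id
    (g := fun p => p.1.1) (by fun_prop)
    (k := fun p => Function.update p.2 e.snd ((p.1.1 e.fst + p.2 e.fst) * p.1.2))
    (measurable_update_apply (by fun_prop) _ (by fun_prop))
    -- Erasing the new coordinate recovers the old conditioning vector, whose entry there is `0`.
    (l := fun b => Function.update b e.snd 0)
    (measurable_update_apply (by fun_prop) _ (by fun_prop)) fun q => by
      simp only [Function.update_idem]
      exact Function.update_eq_self_iff.2 (by simp)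
  convert! h3 using 2 with q
  rw [indicator_eq_update hjB]
  simp only
  rw [indicator_add_indicator_apply hBC0.symm hiCB0, treeVec_snd hT he]

/-- In a single vertex one of `A` and `C` is empty. In the inductive step the part containing the
new leaf decides which rule applies; a leaf in `B` is assigned to the side of its parent, and
symmetry covers the rest. -/
theorem partitionMarkov_univ (m : V) :
    PartitionMarkov hT m (ρ.prod (Measure.pi ν)) Set.univ := by
  refine rootedSubtree_induction hT (m := m) ?_ ?_
  · intro A B C hU hAB hBC hAC _
    by_cases hA : A = ∅
    · subst hA
      simp only [Set.indicator_empty]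
      exact condIndepVar_const 0
    · have hC : C = ∅ := by
        by_contra hC
        obtain ⟨a, ha⟩ := Set.nonempty_iff_ne_empty.2 hA
        obtain ⟨c, hc⟩ := Set.nonempty_iff_ne_empty.2 hC
        have h1 : a ∈ ({m} : Set V) := hU ▸ .inl (.inl ha)
        have h2 : c ∈ ({m} : Set V) := hU ▸ .inr hc
        rw [Set.mem_singleton_iff] at h1 h2
        subst h1
        subst h2
        exact Set.disjoint_left.1 hAC ha hc
      subst hC
      simp only [Set.indicator_empty]
      exact (condIndepVar_const 0).symm measurable_const (measurable_indicator_treeVec hT m A)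
        (measurable_indicator_treeVec hT m B)
  · intro S hS e he hi hj H A B C hU hAB hBC hAC hadj
    have hU' : C ∪ B ∪ A = insert e.snd S := by
      rw [← hU, Set.union_comm C B, Set.union_comm, Set.union_assoc]
    have hadj' : ∀ c ∈ C, ∀ a ∈ A, ¬ T.Adj c a := fun c hc a ha h => hadj a ha c hc h.symm
    have mA := measurable_indicator_treeVec hT m A
    have mB := measurable_indicator_treeVec hT m B
    have mC := measurable_indicator_treeVec hT m C
    have hjU : e.snd ∈ A ∪ B ∪ C := hU ▸ Set.mem_insert _ _
    have hiU : e.fst ∈ A ∪ B ∪ C := hU ▸ Set.mem_insert_of_mem _ hi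
    rcases hjU with (hjA | hjB) | hjC
    · exact H.insert_left hT hS he hi hj hU hAB hBC hAC hadj hjA
    · rcases hiU with (hiA | hiB) | hiC
      · exact (H.insert_middle hT hS he hj hU' hBC.symm hAB.symm hAC.symm hadj' hjB
          (.inl hiA)).symm mC mA mB
      · exact H.insert_middle hT hS he hj hU hAB hBC hAC hadj hjB (.inr hiB)
      · exact H.insert_middle hT hS he hj hU hAB hBC hAC hadj hjB (.inl hiC)
    · exact (H.insert_left hT hS he hi hj hU' hBC.symm hAB.symm hAC.symm hadj' hjC).symm mC mA mB

/-- `A'` collects what can be reached from `A` while avoiding `B`, and `C'` is the remainder. An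
edge from `A'` to `C'` would extend such a walk. -/
theorem Separates.exists_partition {G : SimpleGraph V} {A B C : Set V} (hAB : Disjoint A B)
    (hBC : Disjoint B C) (h : Separates G A B C) :
    ∃ A' C' : Set V, A ⊆ A' ∧ C ⊆ C' ∧ A' ∪ B ∪ C' = Set.univ ∧ Disjoint A' B ∧ Disjoint B C' ∧
      Disjoint A' C' ∧ ∀ a ∈ A', ∀ c ∈ C', ¬ G.Adj a c := by
  classical
  let A' : Set V := {v | ∃ a ∈ A, ∃ p : G.Walk a v, ∀ b ∈ B, b ∉ p.support}
  have hA'B : Disjoint A' B := by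
    rw [Set.disjoint_left]
    rintro v ⟨a, -, p, hp⟩ hv
    exact hp v hv p.end_mem_support
  refine ⟨A', (A' ∪ B)ᶜ, ?_, ?_, Set.union_compl_self _, hA'B, ?_, ?_, ?_⟩
  · intro a ha
    refine ⟨a, ha, .nil, fun b hb hb' => ?_⟩
    rw [SimpleGraph.Walk.support_nil, List.mem_singleton] at hb'
    subst hb'
    exact Set.disjoint_left.1 hAB ha hb
  · rintro c hc (⟨a, ha, p, hp⟩ | hcB)
    · obtain ⟨b, hb, hb'⟩ := h a ha c hc p.bypass p.bypass_isPath
      exact hp b hb (p.support_bypass_subset_support hb')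
    · exact Set.disjoint_left.1 hBC hcB hc
  · exact disjoint_compl_right.mono_left Set.subset_union_right
  · exact disjoint_compl_right.mono_left Set.subset_union_left
  · rintro v ⟨a, ha, p, hp⟩ c hc hvc
    refine hc (.inl ⟨a, ha, p.concat hvc, fun b hb hb' => ?_⟩)
    rw [SimpleGraph.Walk.support_concat, List.mem_append, List.mem_singleton] at hb'
    rcases hb' with hb' | rfl
    · exact hp b hb hb'
    · exact hc (.inr hb)

theorem condIndepVar_treeMeasure (m : V) {A B C : Set V} (hAB : Disjoint A B)
    (hBC : Disjoint B C) (h : Separates T A B C) :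
    CondIndepVar (fun (y : V → ℝ) (a : A) => y a) (fun (y : V → ℝ) (c : C) => y c)
      (fun (y : V → ℝ) (b : B) => y b) (treeMeasure hT m ρ ν) := by
  classical
  obtain ⟨A', C', hAA', hCC', hU, hA'B, hBC', hA'C', hadj⟩ := h.exists_partition hAB hBC
  refine CondIndepVar.of_map (measurable_treeVec hT m) (by fun_prop) (by fun_prop)
    (by fun_prop) ?_
  have h1 := partitionMarkov_univ hT (ρ := ρ) (ν := ν) m A' B C' hU hA'B hBC' hA'C' hadj
  have h2 := h1.comp (measurable_indicator_treeVec hT m C') (measurable_indicator_treeVec hT m B)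
    (f := fun x (a : A) => x a) (by fun_prop) (g := fun p (c : C) => p.1 c) (by fun_prop)
    (k := fun p (b : B) => p.2 b) (by fun_prop)
    (l := fun b v => if hv : v ∈ B then b ⟨v, hv⟩ else 0) (by
      rw [measurable_pi_iff]
      intro v
      by_cases hv : v ∈ B
      · simp only [hv, dite_true]; fun_prop
      · simp [hv]) (fun q => by
      ext v
      by_cases hv : v ∈ B <;> simp [hv])
  convert! h2 using 3 with q a q c q b
  · simp [hAA' a.2]
  · simp [hCC' c.2]
  · simp

end Markov

/-! ### The extremal graphical model property. -/

section GraphicalModel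

variable {V : Type*} [Fintype V] {T : SimpleGraph V} [Fintype T.Dart] (hT : T.IsTree)
  {ν : T.Dart → Measure ℝ} [∀ e, IsProbabilityMeasure (ν e)]

theorem isExtremalGraphicalModel_of_exceedanceLaw {μ : Measure (V → ℝ)}
    (h : ∀ m, exceedanceLaw μ m = treeMeasure hT m stdPareto ν) :
    IsExtremalGraphicalModel T μ := by
  intro A B C hAB hBC hAC hsep m
  rw [← condIndepVar_iff_condIndepFun (by fun_prop) (by fun_prop) (by fun_prop), h m]
  exact condIndepVar_treeMeasure hT m hAB hBC hsep

end GraphicalModel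

/-! ### Scaling identities for Pareto laws. -/

section Homogeneity

variable {V : Type*} [Fintype V] {μ : Measure (V → ℝ)}

theorem IsMultivariatePareto.ae_nonneg (h : IsMultivariatePareto μ) :
    ∀ᵐ x ∂μ, ∀ i, 0 ≤ x i :=
  h.ae_mem_support.mono fun _ hx => hx.1

/-- Since `Y ≥ 0` almost surely, an event inside `{x_m > 1}` and its dilate change only by null sets
when intersected with `𝓛` and its dilate, so homogeneity applies without sign conditions. -/
theorem IsMultivariatePareto.measure_preimage_smul (h : IsMultivariatePareto μ) {t : ℝ}
    (ht : 1 ≤ t) {m : V} {A : Set (V → ℝ)} (hA : MeasurableSet A) (hAm : A ⊆ {x | 1 < x m}) :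
    μ ((fun x => t⁻¹ • x) ⁻¹' A) = (ENNReal.ofReal t)⁻¹ * μ A := by
  have ht0 : 0 < t := by linarith
  have hL := measurableSet_paretoSupport (V := V)
  have e1 : μ A = μ (A ∩ paretoSupport V) := by
    refine measure_congr ?_
    filter_upwards [h.ae_mem_support] with x hx
    exact propext ⟨fun hxA => ⟨hxA, hx⟩, fun hxA => hxA.1⟩
  have e2 : μ ((fun x => t⁻¹ • x) ⁻¹' A) =
      μ ((fun x => t⁻¹ • x) ⁻¹' (A ∩ paretoSupport V)) := by
    refine measure_congr ?_
    filter_upwards [h.ae_nonneg] with x hx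
    refine propext ⟨fun hxA => ⟨hxA, fun i => ?_, m, hAm hxA⟩, fun hxA => hxA.1⟩
    exact mul_nonneg (inv_nonneg.2 ht0.le) (hx i)
  rw [e1, e2, ← image_smul_eq_preimage ht0,
    h.homogeneous t ht _ (hA.inter hL) Set.inter_subset_right]

theorem IsMultivariatePareto.map_smul_restrict (h : IsMultivariatePareto μ) {t : ℝ} (ht : 1 ≤ t)
    (m : V) : (μ.restrict {x | t < x m}).map (fun x => t⁻¹ • x) =
      (ENNReal.ofReal t)⁻¹ • μ.restrict {x | 1 < x m} := by
  have ht0 : 0 < t := by linarith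
  ext s hs
  have hs' : MeasurableSet ((fun x : V → ℝ => t⁻¹ • x) ⁻¹' s) := by
    apply hs.preimage; fun_prop
  rw [Measure.map_apply (by fun_prop) hs, Measure.restrict_apply hs', Measure.smul_apply,
    Measure.restrict_apply hs, smul_eq_mul, ← h.measure_preimage_smul ht
      (hs.inter (measurableSet_one_lt m)) Set.inter_subset_right]
  congr 1
  ext x
  simp only [Set.mem_inter_iff, Set.mem_preimage, Set.mem_ofPred_eq, Pi.smul_apply, smul_eq_mul]
  rw [← div_eq_inv_mul, one_lt_div ht0]

theorem IsMultivariatePareto.isProbabilityMeasure_exceedanceLaw (h : IsMultivariatePareto μ)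
    (m : V) : IsProbabilityMeasure (exceedanceLaw μ m) := by
  have := h.isProbabilityMeasure
  exact cond_isProbabilityMeasure (h.measure_ne_zero m)

theorem exceedanceLaw_apply (m : V) (A : Set (V → ℝ)) :
    exceedanceLaw μ m A = (μ {x | 1 < x m})⁻¹ * μ ({x | 1 < x m} ∩ A) :=
  cond_apply (measurableSet_one_lt m) _ _

theorem IsMultivariatePareto.measure_lt_inter (h : IsMultivariatePareto μ) {t : ℝ} (ht : 1 ≤ t)
    (m : V) {A : Set (V → ℝ)} (hA : MeasurableSet A) :
    μ ({x | t < x m} ∩ (fun x => t⁻¹ • x) ⁻¹' A) =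
      (ENNReal.ofReal t)⁻¹ * μ ({x | 1 < x m} ∩ A) := by
  have := DFunLike.congr_fun (h.map_smul_restrict ht m) A
  have hA' : MeasurableSet ((fun x : V → ℝ => t⁻¹ • x) ⁻¹' A) := by
    apply hA.preimage; fun_prop
  rw [Measure.map_apply (by fun_prop) hA, Measure.restrict_apply hA', Measure.smul_apply,
    Measure.restrict_apply hA, smul_eq_mul] at this
  rw [Set.inter_comm, this, Set.inter_comm]

/-- The standard Pareto law is characterized by its tail. -/
theorem eq_smul_stdPareto {σ : Measure ℝ} [IsFiniteMeasure σ]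
    (h : ∀ t : ℝ, 1 ≤ t → σ (Set.Ioi t) = (ENNReal.ofReal t)⁻¹ * σ Set.univ) :
    σ = σ Set.univ • stdPareto := by
  have h1 : σ (Set.Ioi 1) = σ Set.univ := by simpa using h 1 le_rfl
  have key : ∀ a : ℝ, σ (Set.Ioi a) = (σ Set.univ • stdPareto) (Set.Ioi a) := by
    intro a
    rw [Measure.smul_apply, smul_eq_mul]
    rcases le_or_gt 1 a with ha | ha
    · rw [h a ha, stdPareto_Ioi ha, mul_comm]
    · have e1 : σ (Set.Ioi a) = σ Set.univ :=
        le_antisymm (measure_mono (Set.subset_univ _))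
          (h1 ▸ measure_mono (Set.Ioi_subset_Ioi ha.le))
      have e2 : stdPareto (Set.Ioi a) = 1 := by
        refine le_antisymm prob_le_one ?_
        rw [← show stdPareto (Set.Ioi 1) = 1 by simp [stdPareto_Ioi le_rfl]]
        exact measure_mono (Set.Ioi_subset_Ioi ha.le)
      rw [e1, e2, mul_one]
  have : IsFiniteMeasure (σ Set.univ • stdPareto) :=
    Measure.smul_finite _ (measure_ne_top _ _)
  refine Measure.ext_of_Iic _ _ fun a => ?_
  rw [← Set.compl_Ioi, measure_compl measurableSet_Ioi (measure_ne_top _ _),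
    measure_compl measurableSet_Ioi (measure_ne_top _ _), key a]
  simp

end Homogeneity

/-! ### Radius and profile: the extremal function. -/

section ExtremalFunction

variable {V : Type*} [Fintype V] {μ : Measure (V → ℝ)}

/-- The profile `x / x_m`. -/
noncomputable def profile (m : V) (x : V → ℝ) : V → ℝ := (x m)⁻¹ • x

@[fun_prop]
theorem measurable_profile (m : V) : Measurable (profile m) := by
  rw [measurable_pi_iff]
  intro i
  simp only [profile, Pi.smul_apply, smul_eq_mul]
  fun_prop

theorem profile_smul (m : V) {t : ℝ} (ht : t ≠ 0) (x : V → ℝ) :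
    profile m (t • x) = profile m x := by
  ext i
  simp only [profile, Pi.smul_apply, smul_eq_mul, mul_inv]
  field_simp

theorem ae_exceedanceLaw_gt_one (m : V) : ∀ᵐ x ∂(exceedanceLaw μ m), 1 < x m :=
  ae_cond_mem (measurableSet_one_lt m)

/-- Profile events are scale invariant, so homogeneity gives the radius the tail `t⁻¹` on each of
them. -/
theorem IsMultivariatePareto.map_eval_profile (h : IsMultivariatePareto μ) (m : V) :
    (exceedanceLaw μ m).map (fun x => (x m, profile m x)) =
      stdPareto.prod ((exceedanceLaw μ m).map (profile m)) := by
  have := h.isProbabilityMeasure_exceedanceLaw m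
  have hm : Measurable fun x : V → ℝ => (x m, profile m x) := by fun_prop
  refine Measure.ext_prod fun {s B} hs hB => ?_
  have hB' : MeasurableSet (profile m ⁻¹' B) := measurable_profile m hB
  let σ := ((exceedanceLaw μ m).restrict (profile m ⁻¹' B)).map (fun x => x m)
  have hσuniv : σ Set.univ = exceedanceLaw μ m (profile m ⁻¹' B) := by
    rw [Measure.map_apply (by fun_prop) MeasurableSet.univ]
    simp
  have hσ : σ = σ Set.univ • stdPareto := by
    refine eq_smul_stdPareto fun t ht => ?_
    have ht0 : t ≠ 0 := by positivity
    have hpre : MeasurableSet ((fun x : V → ℝ => x m) ⁻¹' Set.Ioi t) :=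
      measurable_pi_apply m measurableSet_Ioi
    rw [hσuniv, Measure.map_apply (by fun_prop) measurableSet_Ioi, Measure.restrict_apply hpre,
      exceedanceLaw_apply, exceedanceLaw_apply, mul_left_comm, ← h.measure_lt_inter ht m hB']
    congr 2
    ext x
    simp only [Set.mem_inter_iff, Set.mem_preimage, Set.mem_ofPred_eq, Set.mem_Ioi,
      profile_smul m (inv_ne_zero ht0)]
    exact ⟨fun hx => hx.2, fun hx => ⟨lt_of_le_of_lt ht hx.1, hx⟩⟩
  rw [Measure.prod_prod, Measure.map_apply hm (hs.prod hB), Measure.map_apply (by fun_prop) hB,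
    ← hσuniv, mul_comm, ← smul_eq_mul, ← Measure.smul_apply, ← hσ,
    Measure.map_apply (by fun_prop) hs,
    Measure.restrict_apply (measurable_pi_apply m hs)]
  rfl

theorem IsMultivariatePareto.isExtremalFunction_profile (h : IsMultivariatePareto μ) (m : V) :
    IsExtremalFunction μ m ((exceedanceLaw μ m).map (profile m)) := by
  have := h.isProbabilityMeasure_exceedanceLaw m
  refine ⟨Measure.isProbabilityMeasure_map (by fun_prop), ?_, ?_, ?_⟩
  · rw [ae_map_iff (by fun_prop) (by
      rw [Set.ofPred_forall]
      exact MeasurableSet.iInter fun i => measurableSet_le measurable_const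
        (measurable_pi_apply i))]
    have h1 : ∀ᵐ x ∂(exceedanceLaw μ m), ∀ i, 0 ≤ x i :=
      cond_absolutelyContinuous.ae_le h.ae_nonneg
    filter_upwards [h1] with x hx i
    exact mul_nonneg (inv_nonneg.2 (hx m)) (hx i)
  · rw [ae_map_iff (by fun_prop) (measurableSet_eq_fun (by fun_prop) measurable_const)]
    filter_upwards [ae_exceedanceLaw_gt_one m] with x hx
    have : x m ≠ 0 := by positivity
    simp [profile, this]
  · rw [paretoMixture, ← h.map_eval_profile m, Measure.map_map (by fun_prop) (by fun_prop)]
    conv_lhs => rw [← Measure.map_id (μ := exceedanceLaw μ m)]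
    refine Measure.map_congr ?_
    filter_upwards [ae_exceedanceLaw_gt_one m] with x hx
    have : x m ≠ 0 := by positivity
    simp [profile, smul_smul, this]

/-- As `W_m = 1`, the profile of `P W` is `W`, which recovers `ν` from the exceedance law. -/
theorem IsExtremalFunction.eq_map_profile {m : V} {ν : Measure (V → ℝ)}
    (h : IsExtremalFunction μ m ν) : ν = (exceedanceLaw μ m).map (profile m) := by
  have := h.isProbabilityMeasure
  rw [h.exceedanceLaw_eq, paretoMixture, Measure.map_map (by fun_prop) (by fun_prop)]
  have e : (profile m ∘ fun q : ℝ × (V → ℝ) => q.1 • q.2) =ᵐ[stdPareto.prod ν] Prod.snd := by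
    filter_upwards [Measure.quasiMeasurePreserving_fst.ae ae_stdPareto_gt_one,
      Measure.quasiMeasurePreserving_snd.ae h.ae_eq_one] with q h1 h2
    have : q.1 ≠ 0 := by positivity
    simp [profile, h2, smul_smul, this]
  rw [Measure.map_congr e, Measure.map_snd_prod, measure_univ, one_smul]

theorem IsMultivariatePareto.existsUnique_isExtremalFunction (h : IsMultivariatePareto μ)
    (m : V) : ∃! ν, IsExtremalFunction μ m ν :=
  ⟨_, h.isExtremalFunction_profile m, fun _ hν => hν.eq_map_profile⟩

theorem IsExtremalFunction.map_eval {m : V} {ν : Measure (V → ℝ)}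
    (h : IsExtremalFunction μ m ν) : (exceedanceLaw μ m).map (fun x => x m) = stdPareto := by
  have := h.isProbabilityMeasure
  rw [h.exceedanceLaw_eq, paretoMixture, Measure.map_map (by fun_prop) (by fun_prop)]
  have e : ((fun x : V → ℝ => x m) ∘ fun q : ℝ × (V → ℝ) => q.1 • q.2) =ᵐ[stdPareto.prod ν]
      Prod.fst := by
    filter_upwards [Measure.quasiMeasurePreserving_snd.ae h.ae_eq_one] with q h2
    simp [h2]
  rw [Measure.map_congr e, Measure.map_fst_prod, measure_univ, one_smul]

theorem measurable_measure_mul_mem {ν : Measure ℝ} [SFinite ν] {F : Set ℝ}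
    (hF : MeasurableSet F) : Measurable fun y : ℝ => ν {u | y * u ∈ F} := by
  have : MeasurableSet ((fun p : ℝ × ℝ => p.1 * p.2) ⁻¹' F) := by
    apply hF.preimage; fun_prop
  exact measurable_measure_prodMk_left this

/-- `Y_i` is the Pareto radius itself, so given `Y_i = y` the coordinate `Y_j` is distributed as `y
W_j`. -/
theorem IsExtremalFunction.map_restrict_eval {i : V} {ν : Measure (V → ℝ)}
    (h : IsExtremalFunction μ i ν) (j : V) {F : Set ℝ} (hF : MeasurableSet F) :
    ((exceedanceLaw μ i).restrict ((fun x => x j) ⁻¹' F)).map (fun x => x i) =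
      ((exceedanceLaw μ i).map (fun x => x i)).withDensity
        (fun y => (ν.map (fun w => w j)) {u | y * u ∈ F}) := by
  have := h.isProbabilityMeasure
  have : IsProbabilityMeasure (ν.map (fun w => w j)) :=
    Measure.isProbabilityMeasure_map (measurable_pi_apply j).aemeasurable
  ext D hD
  have hDi : MeasurableSet ((fun x : V → ℝ => x i) ⁻¹' D) := measurable_pi_apply i hD
  have hFj : MeasurableSet ((fun x : V → ℝ => x j) ⁻¹' F) := measurable_pi_apply j hF
  rw [Measure.map_apply (by fun_prop) hD, Measure.restrict_apply hDi, withDensity_apply _ hD,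
    h.map_eval, h.exceedanceLaw_eq, paretoMixture,
    Measure.map_apply (by fun_prop) (hDi.inter hFj)]
  have e : (fun q : ℝ × (V → ℝ) => q.1 • q.2) ⁻¹'
      ((fun x => x i) ⁻¹' D ∩ (fun x => x j) ⁻¹' F) =ᵐ[stdPareto.prod ν]
      {q : ℝ × (V → ℝ) | q.1 ∈ D ∧ q.1 * q.2 j ∈ F} := by
    filter_upwards [Measure.quasiMeasurePreserving_snd.ae h.ae_eq_one] with q h2
    refine propext ?_
    change (q.1 * q.2 i ∈ D ∧ q.1 * q.2 j ∈ F) ↔ _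
    rw [h2, mul_one]
    rfl
  have hm : MeasurableSet {q : ℝ × (V → ℝ) | q.1 ∈ D ∧ q.1 * q.2 j ∈ F} := by
    refine MeasurableSet.inter (measurable_fst hD) ?_
    apply hF.preimage (f := fun q : ℝ × (V → ℝ) => q.1 * q.2 j)
    fun_prop
  rw [measure_congr e, Measure.prod_apply hm, ← lintegral_indicator hD]
  refine lintegral_congr fun r => ?_
  have hFr : MeasurableSet {u : ℝ | r * u ∈ F} := by
    apply hF.preimage; fun_prop
  by_cases hr : r ∈ D
  · rw [Set.indicator_of_mem hr, Measure.map_apply (by fun_prop) hFr]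
    congr 1
    ext w
    simp [hr]
  · rw [Set.indicator_of_notMem hr]
    convert measure_empty (μ := ν)
    ext w
    simp [hr]

end ExtremalFunction

/-! ### Transition along an edge: zeros and scaling. -/

section Representation

variable {V : Type*} [Fintype V] {T : SimpleGraph V} {μ : Measure (V → ℝ)}

theorem measurableSet_preimage_indicator (S : Set V) {G : Set (V → ℝ)} (hG : MeasurableSet G) :
    MeasurableSet {x : V → ℝ | S.indicator x ∈ G} :=
  measurable_indicator_pi S hG

/-- The edge Markov property: given `Y_i`, the neighbour `Y_j` outside the rooted subtree `S ∋ i`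
is independent of `Y_S`. -/
theorem IsExtremalGraphicalModel.condIndepVar_edge (hT : T.IsTree)
    (hG : IsExtremalGraphicalModel T μ) {m : V}
    {S : Set V} (hS : IsRootedSubtree T m S) {e : T.Dart} (hi : e.fst ∈ S) (hj : e.snd ∉ S)
    (k : V) : CondIndepVar (fun x : V → ℝ => x e.snd) (fun x => S.indicator x)
      (fun x => x e.fst) (exceedanceLaw μ k) := by
  classical
  have hne : e.snd ≠ e.fst := e.adj.ne'
  have h1 := hG {e.snd} {e.fst} (S \ {e.fst}) (by simp [hne])
    (Set.disjoint_left.2 fun v hv hv' => hv'.2 hv)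
    (Set.disjoint_left.2 fun v hv hv' => hj ((Set.mem_singleton_iff.1 hv) ▸ hv'.1))
    (hS.separates hT hi hj) k
  rw [← condIndepVar_iff_condIndepFun (by fun_prop) (by fun_prop) (by fun_prop)] at h1
  have h2 := h1.comp (by fun_prop) (by fun_prop)
    (f := fun z => z ⟨e.snd, rfl⟩) (by fun_prop)
    -- The graphical model gives independence from `S` without the tail of `e`; the tail is put back
    -- from the conditioning variable.
    (g := fun p v => if hv : v ∈ S \ {e.fst} then p.1 ⟨v, hv⟩ else
      if v = e.fst then p.2 ⟨e.fst, rfl⟩ else 0) (by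
        rw [measurable_pi_iff]
        intro v
        split_ifs <;> fun_prop)
    (k := fun p => p.2 ⟨e.fst, rfl⟩) (by fun_prop)
    (l := fun r _ => r) (by fun_prop) (fun x => by
      ext ⟨v, hv⟩
      obtain rfl := Set.mem_singleton_iff.1 hv
      rfl)
  convert! h2 using 3 with x v
  by_cases hvi : v = e.fst
  · subst hvi
    simp [hi]
  · by_cases hvS : v ∈ S
    · simp [hvS, hvi]
    · simp [hvS, hvi]

/-- A vanishing coordinate `Y_i` forces the coordinates behind `i`, as seen from `m`, to vanish. -/
theorem IsMultivariatePareto.measure_zero_edge (hT : T.IsTree)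
    (h : IsMultivariatePareto μ)
    (hG : IsExtremalGraphicalModel T μ) {m : V} {S : Set V} (hS : IsRootedSubtree T m S)
    {e : T.Dart} (hi : e.fst ∈ S) (hj : e.snd ∉ S) :
    μ {x | 1 < x m ∧ x e.fst = 0 ∧ 1 < x e.snd} = 0 := by
  have := h.isProbabilityMeasure
  have := h.isProbabilityMeasure_exceedanceLaw e.snd
  set E := exceedanceLaw μ e.snd with hE
  have hci := hG.condIndepVar_edge hT hS hi hj e.snd
  have m0 : MeasurableSet {x : V → ℝ | x e.fst = 0} :=
    measurableSet_eq_fun (by fun_prop) measurable_const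
  have mlt : ∀ (v : V) (s : ℝ), MeasurableSet {x : V → ℝ | s < x v} := fun v s =>
    measurableSet_lt measurable_const (measurable_pi_apply v)
  have hSm : ∀ x : V → ℝ, S.indicator x m = x m := fun x =>
    Set.indicator_of_mem hS.root_mem x
  have hom : ∀ t : ℝ, 1 ≤ t → ∀ A : Set (V → ℝ), MeasurableSet A →
      E ({x | t < x e.snd} ∩ (fun x => t⁻¹ • x) ⁻¹' A) = (ENNReal.ofReal t)⁻¹ * E A := by
    intro t ht A hA
    have hsub : {x : V → ℝ | t < x e.snd} ⊆ {x | 1 < x e.snd} :=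
      fun x (hx : t < x e.snd) => show 1 < x e.snd from lt_of_le_of_lt ht hx
    rw [hE, exceedanceLaw_apply, exceedanceLaw_apply, ← Set.inter_assoc,
      Set.inter_eq_right.2 hsub,
      h.measure_lt_inter ht _ hA, mul_left_comm]
  -- The event `{x_i = 0}` is scale invariant. Given it, `{x_j > t}` has probability `g 0`, and
  -- scaling forces `g 0 = t⁻¹`. The probability of `{x_j > t, x_m > t, x_i = 0}` is then `t⁻¹`
  -- times that of `{x_m > t, x_i = 0}` by independence, and `t⁻¹` times that of `{x_m > 1, x_i =
  -- 0}` by scaling.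
  have key : ∀ t : ℝ, 1 ≤ t →
      E ({x | 1 < x m} ∩ {x | x e.fst = 0}) = E ({x | t < x m} ∩ {x | x e.fst = 0}) := by
    intro t ht
    have ht0 : 0 < t := by linarith
    by_cases hq : E {x | x e.fst = 0} = 0
    · rw [measure_mono_null Set.inter_subset_right hq, measure_mono_null Set.inter_subset_right hq]
    obtain ⟨g, hg, eg⟩ := hci (Set.Ioi t) measurableSet_Ioi
    have mp : Measurable fun x : V → ℝ => (S.indicator x, x e.fst) :=
      (measurable_indicator_pi S).prodMk (measurable_pi_apply _)
    have eval : ∀ B : Set (V → ℝ), MeasurableSet B →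
        E ({x | t < x e.snd} ∩ ({x | S.indicator x ∈ B} ∩ {x | x e.fst = 0})) =
          g 0 * E ({x | S.indicator x ∈ B} ∩ {x | x e.fst = 0}) := by
      intro B hB
      have mB := (measurableSet_preimage_indicator S hB).inter m0
      have hB0 : MeasurableSet (B ×ˢ ({0} : Set ℝ)) := hB.prod (measurableSet_singleton 0)
      have e1 := DFunLike.congr_fun eg (B ×ˢ {0})
      rw [Measure.map_apply mp hB0, Measure.restrict_apply (mp hB0), withDensity_apply _ hB0,
        setLIntegral_map hB0 (by fun_prop) mp] at e1
      have e2 : (fun x : V → ℝ => (S.indicator x, x e.fst)) ⁻¹' (B ×ˢ {0}) =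
          {x | S.indicator x ∈ B} ∩ {x | x e.fst = 0} := by
        ext; simp
      rw [e2, setLIntegral_congr_fun (g := fun _ => g 0) mB (fun x hx => by
        simp only [show x e.fst = 0 from hx.2]), setLIntegral_const, Set.inter_comm] at e1
      exact e1
    have a1 := eval Set.univ MeasurableSet.univ
    have a2 := eval {z | t < z m} (mlt m t)
    simp only [Set.mem_univ, Set.ofPred_true, Set.univ_inter, Set.mem_ofPred_eq, hSm] at a1 a2
    have b1 := hom t ht _ m0
    have b2 := hom t ht _ ((mlt m 1).inter m0)
    have c1 : (fun x : V → ℝ => t⁻¹ • x) ⁻¹' {x | x e.fst = 0} = {x | x e.fst = 0} := by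
      ext x; simp [ht0.ne']
    have c2 : (fun x : V → ℝ => t⁻¹ • x) ⁻¹' ({x | 1 < x m} ∩ {x | x e.fst = 0}) =
        {x | t < x m} ∩ {x | x e.fst = 0} := by
      ext x
      simp only [Set.mem_preimage, Set.mem_inter_iff, Set.mem_ofPred_eq, Pi.smul_apply,
        smul_eq_mul, mul_eq_zero, inv_eq_zero, ht0.ne', false_or]
      rw [← div_eq_inv_mul, one_lt_div ht0]
    rw [c1] at b1
    rw [c2] at b2
    have hg0 : g 0 = (ENNReal.ofReal t)⁻¹ := by
      rw [a1] at b1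
      exact (ENNReal.mul_left_inj hq (measure_ne_top _ _)).1 b1
    rw [a2, hg0] at b2
    exact ((ENNReal.mul_right_inj (ENNReal.inv_ne_zero.2 ENNReal.ofReal_ne_top)
      (ENNReal.inv_ne_top.2 (ENNReal.ofReal_pos.2 ht0).ne')).1 b2).symm
  -- A probability that does not depend on `t` but tends to `0` as `t → ∞` is `0`.
  have hzero : E ({x | 1 < x m} ∩ {x | x e.fst = 0}) = 0 := by
    have hanti : Antitone fun n : ℕ => {x : V → ℝ | (n : ℝ) + 1 < x m} ∩ {x | x e.fst = 0} := by
      intro a b hab x hx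
      refine ⟨show (a : ℝ) + 1 < x m from lt_of_le_of_lt ?_ hx.1, hx.2⟩
      have : (a : ℝ) ≤ b := by exact_mod_cast hab
      linarith
    have hlim := tendsto_measure_iInter_atTop (μ := E)
      (s := fun n : ℕ => {x : V → ℝ | (n : ℝ) + 1 < x m} ∩ {x | x e.fst = 0})
      (fun n => ((mlt m _).inter m0).nullMeasurableSet) hanti ⟨0, measure_ne_top _ _⟩
    have hempty : (⋂ n : ℕ, {x : V → ℝ | (n : ℝ) + 1 < x m} ∩ {x | x e.fst = 0}) = ∅ := by
      refine Set.eq_empty_iff_forall_notMem.2 fun x hx => ?_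
      obtain ⟨n, hn⟩ := exists_nat_gt (x m)
      have := (Set.mem_iInter.1 hx n).1
      simp only [Set.mem_ofPred_eq] at this
      linarith
    rw [hempty, measure_empty] at hlim
    have hconst : (fun n : ℕ => E ({x : V → ℝ | (n : ℝ) + 1 < x m} ∩ {x | x e.fst = 0})) =
        fun _ => E ({x | 1 < x m} ∩ {x | x e.fst = 0}) := by
      funext n
      refine (key _ ?_).symm
      have : (0 : ℝ) ≤ n := n.cast_nonneg
      linarith
    have hlim' : Filter.Tendsto (fun _ : ℕ => E ({x | 1 < x m} ∩ {x | x e.fst = 0}))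
        Filter.atTop (nhds 0) := by
      rw [← hconst]; exact hlim
    exact tendsto_nhds_unique tendsto_const_nhds hlim'
  rw [hE, exceedanceLaw_apply] at hzero
  have hz := (mul_eq_zero.1 hzero).resolve_left (ENNReal.inv_ne_zero.2 (measure_ne_top _ _))
  rw [← hz]
  congr 1
  ext x
  simp only [Set.mem_inter_iff, Set.mem_ofPred_eq]
  tauto

/-- Dilation by `n + 1` lifts the threshold `1 / (n + 1)` for the head to `1`, where the event is
already known to be null. -/
theorem IsMultivariatePareto.ae_snd_eq_zero (hT : T.IsTree)
    (h : IsMultivariatePareto μ)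
    (hG : IsExtremalGraphicalModel T μ) {m : V} {S : Set V} (hS : IsRootedSubtree T m S)
    {e : T.Dart} (hi : e.fst ∈ S) (hj : e.snd ∉ S) :
    ∀ᵐ x ∂μ, 1 < x m → x e.fst = 0 → x e.snd = 0 := by
  have h0 := h.measure_zero_edge hT hG hS hi hj
  have mlt : ∀ (v : V) (s : ℝ), MeasurableSet {x : V → ℝ | s < x v} := fun v s =>
    measurableSet_lt measurable_const (measurable_pi_apply v)
  have hn : ∀ n : ℕ, ∀ᵐ x ∂μ, ¬ (1 < x m ∧ x e.fst = 0 ∧ ((n : ℝ) + 1)⁻¹ < x e.snd) := by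
    intro n
    have ht : (1 : ℝ) ≤ (n : ℝ) + 1 := by
      have : (0 : ℝ) ≤ n := n.cast_nonneg
      linarith
    have ht0 : (0 : ℝ) < (n : ℝ) + 1 := by linarith
    have hm : MeasurableSet {x : V → ℝ | x e.fst = 0 ∧ ((n : ℝ) + 1)⁻¹ < x e.snd} :=
      (measurableSet_eq_fun (measurable_pi_apply _) measurable_const).inter (mlt _ _)
    have h1 := h.measure_lt_inter ht m hm
    rw [measure_mono_null (fun x hx => ?_) h0] at h1
    · have h2 := (mul_eq_zero.1 h1.symm).resolve_left
        (ENNReal.inv_ne_zero.2 ENNReal.ofReal_ne_top)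
      rw [ae_iff]
      simp only [not_not]
      exact h2
    · obtain ⟨hx1, hx2, hx3⟩ := hx
      simp only [Set.mem_ofPred_eq, Pi.smul_apply, smul_eq_mul, mul_eq_zero, inv_eq_zero,
        ht0.ne', false_or] at hx1 hx2 hx3 ⊢
      refine ⟨lt_of_le_of_lt ht hx1, hx2, ?_⟩
      by_contra hc
      have := mul_le_of_le_one_right (inv_pos.2 ht0).le (not_lt.1 hc)
      linarith
  filter_upwards [ae_all_iff.2 hn, h.ae_nonneg] with x hx hx0 hm hxi
  by_contra hc
  have hpos : 0 < x e.snd := lt_of_le_of_ne (hx0 _) (Ne.symm hc)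
  obtain ⟨n, hn⟩ := exists_nat_one_div_lt hpos
  rw [one_div] at hn
  exact hx n ⟨hm, hxi, hn⟩

variable {ν : V → Measure (V → ℝ)}

/-- The law of the edge variable `W_e = W^i_j`, `e = (i, j)`. -/
noncomputable def edgeLaw (T : SimpleGraph V) (ν : V → Measure (V → ℝ)) (e : T.Dart) : Measure ℝ :=
  (ν e.fst).map (fun w => w e.snd)

theorem isProbabilityMeasure_edgeLaw (hν : ∀ i, IsExtremalFunction μ i (ν i)) (e : T.Dart) :
    IsProbabilityMeasure (edgeLaw T ν e) := by
  have := (hν e.fst).isProbabilityMeasure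
  exact Measure.isProbabilityMeasure_map (measurable_pi_apply _).aemeasurable

/-- On `{x_i > 1}` the law is that of `Yⁱ` up to a constant, so the edge Markov property with the
kernel `y ↦` law of `y W_e` applies directly. -/
theorem IsMultivariatePareto.setLIntegral_edge_one (hT : T.IsTree)
    (h : IsMultivariatePareto μ)
    (hG : IsExtremalGraphicalModel T μ) (hν : ∀ i, IsExtremalFunction μ i (ν i)) {m : V}
    {S : Set V} (hS : IsRootedSubtree T m S) {e : T.Dart} (hi : e.fst ∈ S) (hj : e.snd ∉ S)
    {B : Set (V → ℝ)} (hB : MeasurableSet B) {F : Set ℝ} (hF : MeasurableSet F) :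
    μ ({x | 1 < x e.fst} ∩ {x | S.indicator x ∈ B} ∩ {x | x e.snd ∈ F}) =
      ∫⁻ x in {x | 1 < x e.fst} ∩ {x | S.indicator x ∈ B},
        edgeLaw T ν e {u | x e.fst * u ∈ F} ∂μ := by
  have := h.isProbabilityMeasure
  have := h.isProbabilityMeasure_exceedanceLaw e.fst
  have := isProbabilityMeasure_edgeLaw hν e
  have hκ : Measurable fun y : ℝ => edgeLaw T ν e {u | y * u ∈ F} :=
    measurable_measure_mul_mem hF
  have mB := measurableSet_preimage_indicator S hB
  have mF : MeasurableSet {x : V → ℝ | x e.snd ∈ F} := measurable_pi_apply _ hF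
  have mp : Measurable fun x : V → ℝ => (S.indicator x, x e.fst) :=
    (measurable_indicator_pi S).prodMk (measurable_pi_apply _)
  have h1 := (hG.condIndepVar_edge hT hS hi hj e.fst).map_restrict_eq (measurable_indicator_pi S)
    (measurable_pi_apply _) hF hκ ((hν e.fst).map_restrict_eval e.snd hF)
  have h2 := DFunLike.congr_fun h1 (B ×ˢ Set.univ)
  have hκ2 : Measurable fun p : (V → ℝ) × ℝ => edgeLaw T ν e {u | p.2 * u ∈ F} :=
    hκ.comp measurable_snd
  have hBu : MeasurableSet (B ×ˢ (Set.univ : Set ℝ)) := hB.prod MeasurableSet.univ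
  rw [Measure.map_apply mp hBu, Measure.restrict_apply (mp hBu), withDensity_apply _ hBu,
    setLIntegral_map hBu hκ2 mp] at h2
  have e2 : (fun x : V → ℝ => (S.indicator x, x e.fst)) ⁻¹' (B ×ˢ Set.univ) =
      {x | S.indicator x ∈ B} := by
    ext; simp
  rw [e2, exceedanceLaw_apply, exceedanceLaw, ProbabilityTheory.cond, Measure.restrict_smul,
    lintegral_smul_measure, smul_eq_mul, Measure.restrict_restrict mB,
    ENNReal.mul_right_inj (ENNReal.inv_ne_zero.2 (measure_ne_top _ _))
      (ENNReal.inv_ne_top.2 (h.measure_ne_zero _))] at h2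
  rw [Set.inter_assoc, Set.inter_comm {x : V → ℝ | 1 < x e.fst} {x | S.indicator x ∈ B}]
  exact h2

theorem IsMultivariatePareto.setLIntegral_edge (hT : T.IsTree)
    (h : IsMultivariatePareto μ)
    (hG : IsExtremalGraphicalModel T μ) (hν : ∀ i, IsExtremalFunction μ i (ν i)) {m : V}
    {S : Set V} (hS : IsRootedSubtree T m S) {e : T.Dart} (hi : e.fst ∈ S) (hj : e.snd ∉ S)
    {B : Set (V → ℝ)} (hB : MeasurableSet B) {F : Set ℝ} (hF : MeasurableSet F) {t : ℝ}
    (ht : 1 ≤ t) :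
    μ ({x | 1 < x m} ∩ ({x | t⁻¹ < x e.fst} ∩ {x | S.indicator x ∈ B} ∩ {x | x e.snd ∈ F})) =
      ∫⁻ x in {x | 1 < x m} ∩ ({x | t⁻¹ < x e.fst} ∩ {x | S.indicator x ∈ B}),
        edgeLaw T ν e {u | x e.fst * u ∈ F} ∂μ := by
  have ht0 : 0 < t := by linarith
  have := isProbabilityMeasure_edgeLaw hν e
  have hκ : Measurable fun y : ℝ => edgeLaw T ν e {u | y * u ∈ F} :=
    measurable_measure_mul_mem hF
  have mlt : ∀ (v : V) (s : ℝ), MeasurableSet {x : V → ℝ | s < x v} := fun v s =>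
    measurableSet_lt measurable_const (measurable_pi_apply v)
  have mB := measurableSet_preimage_indicator S hB
  have mF : MeasurableSet {x : V → ℝ | x e.snd ∈ F} := measurable_pi_apply _ hF
  have mA := (mlt e.fst t⁻¹).inter mB
  -- Dilation by `t` turns `{x_m > 1, x_i > 1/t}` into `{x_m > t, x_i > 1}`. The condition on `x_m`
  -- is an event of the subvector on `S`, since the root lies in `S`, so it can be absorbed into
  -- `B`.
  let B' : Set (V → ℝ) := {z | t < z m} ∩ (fun z => t⁻¹ • z) ⁻¹' B
  have hB' : MeasurableSet B' := (mlt m t).inter (by apply hB.preimage; fun_prop)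
  have hF' : MeasurableSet ((fun y : ℝ => t⁻¹ * y) ⁻¹' F) := by
    apply hF.preimage; fun_prop
  have one := h.setLIntegral_edge_one hT hG hν hS hi hj hB' hF'
  have hind : ∀ x : V → ℝ, S.indicator (t⁻¹ • x) = t⁻¹ • S.indicator x := fun x =>
    Set.indicator_const_smul S t⁻¹ x
  have hlt : ∀ y : ℝ, t⁻¹ < t⁻¹ * y ↔ 1 < y := fun y => by
    rw [lt_mul_iff_one_lt_right (inv_pos.2 ht0)]
  have pre : {x : V → ℝ | t < x m} ∩ (fun x => t⁻¹ • x) ⁻¹'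
      ({x | t⁻¹ < x e.fst} ∩ {x | S.indicator x ∈ B}) =
      {x | 1 < x e.fst} ∩ {x | S.indicator x ∈ B'} := by
    ext x
    simp only [Set.mem_inter_iff, Set.mem_preimage, Set.mem_ofPred_eq, hind, Pi.smul_apply,
      smul_eq_mul, hlt, B', Set.indicator_of_mem hS.root_mem]
    tauto
  have lhs := h.measure_lt_inter ht m (mA.inter mF)
  have pre2 : {x : V → ℝ | t < x m} ∩ (fun x => t⁻¹ • x) ⁻¹'
      ({x | t⁻¹ < x e.fst} ∩ {x | S.indicator x ∈ B} ∩ {x | x e.snd ∈ F}) =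
      {x | 1 < x e.fst} ∩ {x | S.indicator x ∈ B'} ∩
        {x | x e.snd ∈ (fun y : ℝ => t⁻¹ * y) ⁻¹' F} := by
    rw [← pre, Set.preimage_inter, ← Set.inter_assoc]
    rfl
  rw [pre2, one, ← pre] at lhs
  have rhs : ∫⁻ x in {x | t < x m} ∩ (fun x => t⁻¹ • x) ⁻¹'
      ({x | t⁻¹ < x e.fst} ∩ {x | S.indicator x ∈ B}),
        edgeLaw T ν e {u | x e.fst * u ∈ (fun y : ℝ => t⁻¹ * y) ⁻¹' F} ∂μ =
      (ENNReal.ofReal t)⁻¹ * ∫⁻ x in {x | 1 < x m} ∩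
        ({x | t⁻¹ < x e.fst} ∩ {x | S.indicator x ∈ B}),
          edgeLaw T ν e {u | x e.fst * u ∈ F} ∂μ := by
    have mpre : MeasurableSet ((fun x : V → ℝ => t⁻¹ • x) ⁻¹'
        ({x | t⁻¹ < x e.fst} ∩ {x | S.indicator x ∈ B})) := by
      apply mA.preimage; fun_prop
    have hf : Measurable fun x : V → ℝ => edgeLaw T ν e {u | x e.fst * u ∈ F} :=
      hκ.comp (measurable_pi_apply _)
    have e1 : ((μ.restrict {x | t < x m}).map (fun x => t⁻¹ • x)).restrict
        ({x | t⁻¹ < x e.fst} ∩ {x | S.indicator x ∈ B}) =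
        ((ENNReal.ofReal t)⁻¹ • μ.restrict {x | 1 < x m}).restrict
          ({x | t⁻¹ < x e.fst} ∩ {x | S.indicator x ∈ B}) := by
      rw [h.map_smul_restrict ht m]
    have e2 := congrArg (fun σ => ∫⁻ x, edgeLaw T ν e {u | x e.fst * u ∈ F} ∂σ) e1
    rw [setLIntegral_map mA hf (by fun_prop), Measure.restrict_restrict mpre,
      Measure.restrict_smul, lintegral_smul_measure, Measure.restrict_restrict mA, smul_eq_mul,
      Set.inter_comm, Set.inter_comm _ {x : V → ℝ | 1 < x m}] at e2
    rw [← e2]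
    refine lintegral_congr fun x => ?_
    congr 1
    ext u
    simp [mul_assoc]
  rw [rhs] at lhs
  exact ((ENNReal.mul_right_inj (ENNReal.inv_ne_zero.2 ENNReal.ofReal_ne_top)
      (ENNReal.inv_ne_top.2 (ENNReal.ofReal_pos.2 ht0).ne')).1 lhs).symm

end Representation

/-! ### Growing the representation over the tree. -/

section Representation

variable {V : Type*} [Fintype V] {T : SimpleGraph V} {μ : Measure (V → ℝ)}
  {ν : V → Measure (V → ℝ)}

theorem IsMultivariatePareto.map_indicator_edge (h : IsMultivariatePareto μ) (hT : T.IsTree)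
    (hG : IsExtremalGraphicalModel T μ) (hν : ∀ i, IsExtremalFunction μ i (ν i)) {m : V}
    {S : Set V} (hS : IsRootedSubtree T m S) {e : T.Dart} (hi : e.fst ∈ S) (hj : e.snd ∉ S)
    {F : Set ℝ} (hF : MeasurableSet F) :
    ((μ.restrict {x | 1 < x m}).restrict {x | x e.snd ∈ F}).map (fun x => S.indicator x) =
      ((μ.restrict {x | 1 < x m}).withDensity
        (fun x => edgeLaw T ν e {u | x e.fst * u ∈ F})).map (fun x => S.indicator x) := by
  have := h.isProbabilityMeasure
  have hpe := isProbabilityMeasure_edgeLaw hν e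
  have hκ : Measurable fun x : V → ℝ => edgeLaw T ν e {u | x e.fst * u ∈ F} :=
    (measurable_measure_mul_mem hF).comp (measurable_pi_apply e.fst)
  have mF : MeasurableSet {x : V → ℝ | x e.snd ∈ F} := measurable_pi_apply _ hF
  have mS := measurable_indicator_pi S
  have hind : ∀ x : V → ℝ, S.indicator x e.fst = x e.fst := fun x => Set.indicator_of_mem hi x
  have mlt : ∀ (v : V) (s : ℝ), MeasurableSet {x : V → ℝ | s < x v} := fun v s =>
    measurableSet_lt measurable_const (measurable_pi_apply v)
  have m0 : MeasurableSet {x : V → ℝ | x e.fst = 0} :=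
    measurableSet_eq_fun (measurable_pi_apply _) measurable_const
  have lhs : ∀ B : Set (V → ℝ), MeasurableSet B →
      ((μ.restrict {x | 1 < x m}).restrict {x | x e.snd ∈ F}).map (fun x => S.indicator x) B =
        μ ({x | 1 < x m} ∩ ({x | S.indicator x ∈ B} ∩ {x | x e.snd ∈ F})) := by
    intro B hB
    rw [Measure.map_apply mS hB, Measure.restrict_apply (mS hB),
      Measure.restrict_apply ((mS hB).inter mF), Set.inter_comm]
    rfl
  have rhs : ∀ B : Set (V → ℝ), MeasurableSet B →
      ((μ.restrict {x | 1 < x m}).withDensity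
        (fun x => edgeLaw T ν e {u | x e.fst * u ∈ F})).map (fun x => S.indicator x) B =
        ∫⁻ x in {x | 1 < x m} ∩ {x | S.indicator x ∈ B},
          edgeLaw T ν e {u | x e.fst * u ∈ F} ∂μ := by
    intro B hB
    rw [Measure.map_apply mS hB, withDensity_apply _ (mS hB),
      Measure.restrict_restrict (mS hB), Set.inter_comm]
    rfl
  -- The values `x_i ≥ 0` are covered by `x_i = 0` (`none`) and `x_i > 1 / (n + 1)`; the positive
  -- pieces come from scaling.
  let P : Option ℕ → Set (V → ℝ) := fun o =>
    o.elim {z | z e.fst = 0} fun n => {z | ((n : ℝ) + 1)⁻¹ < z e.fst}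
  have hPmem : ∀ z : V → ℝ, 0 ≤ z e.fst → z ∈ ⋃ o, P o := by
    intro z hz
    rcases hz.eq_or_lt with h0 | h0
    · exact Set.mem_iUnion_of_mem none h0.symm
    · obtain ⟨n, hn⟩ := exists_nat_one_div_lt h0
      rw [one_div] at hn
      exact Set.mem_iUnion_of_mem (some n) hn
  have hPm : MeasurableSet (⋃ o, P o) := by
    refine MeasurableSet.iUnion fun o => ?_
    cases o with
    | none => exact m0
    | some n => exact mlt _ _
  have hae : ∀ᵐ x ∂(μ.restrict {x | 1 < x m}), S.indicator x ∈ ⋃ o, P o := by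
    filter_upwards [ae_restrict_of_ae h.ae_nonneg] with x hx
    exact hPmem _ (by rw [hind]; exact hx _)
  refine measure_eq_of_restrict_eq (P := P) (fun o => ?_) ?_ ?_
  · have hPo : MeasurableSet (P o) := by
      cases o with
      | none => exact m0
      | some n => exact mlt _ _
    ext B hB
    rw [Measure.restrict_apply hB, Measure.restrict_apply hB, lhs _ (hB.inter hPo),
      rhs _ (hB.inter hPo)]
    cases o with
    | none =>
      have hset : {x : V → ℝ | S.indicator x ∈ B ∩ P none} =
          {x | S.indicator x ∈ B} ∩ {x | x e.fst = 0} := by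
        ext x
        simp [P, hind]
      rw [hset]
      have mU : MeasurableSet ({x : V → ℝ | 1 < x m} ∩
          ({x | S.indicator x ∈ B} ∩ {x | x e.fst = 0})) := (mlt _ _).inter ((mS hB).inter m0)
      -- At `y = 0` the kernel is the point mass at `0`, matching the fact that `x_j` vanishes with
      -- `x_i`.
      by_cases h0 : (0 : ℝ) ∈ F
      · rw [setLIntegral_congr_fun (g := fun _ => 1) mU (fun x hx => by
          simp [show x e.fst = 0 from hx.2.2, h0]), setLIntegral_one]
        refine measure_congr ?_
        filter_upwards [h.ae_snd_eq_zero hT hG hS hi hj] with x hx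
        refine propext ⟨fun hx' => ⟨hx'.1, hx'.2.1⟩, fun hx' => ⟨hx'.1, hx'.2, ?_⟩⟩
        change x e.snd ∈ F
        rw [hx hx'.1 hx'.2.2]
        exact h0
      · rw [setLIntegral_congr_fun (g := fun _ => 0) mU (fun x hx => by
          simp [show x e.fst = 0 from hx.2.2, h0]), lintegral_zero]
        refine measure_eq_zero_iff_ae_notMem.2 ?_
        filter_upwards [h.ae_snd_eq_zero hT hG hS hi hj] with x hx hx'
        have hxF : x e.snd ∈ F := hx'.2.2
        rw [hx hx'.1 hx'.2.1.2] at hxF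
        exact h0 hxF
    | some n =>
      have ht : (1 : ℝ) ≤ (n : ℝ) + 1 := by
        have : (0 : ℝ) ≤ n := n.cast_nonneg
        linarith
      have hset : {x : V → ℝ | S.indicator x ∈ B ∩ P (some n)} =
          {x | ((n : ℝ) + 1)⁻¹ < x e.fst} ∩ {x | S.indicator x ∈ B} := by
        ext x
        simp [P, hind, and_comm]
      rw [hset]
      exact h.setLIntegral_edge hT hG hν hS hi hj hB hF ht
  · exact (ae_map_iff mS.aemeasurable hPm).2 (ae_restrict_of_ae hae)
  · exact (ae_map_iff mS.aemeasurable hPm).2 ((withDensity_absolutelyContinuous _ _).ae_le hae)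

theorem IsMultivariatePareto.map_indicator_prodMk (h : IsMultivariatePareto μ) (hT : T.IsTree)
    (hG : IsExtremalGraphicalModel T μ) (hν : ∀ i, IsExtremalFunction μ i (ν i)) {m : V}
    {S : Set V} (hS : IsRootedSubtree T m S) {e : T.Dart} (hi : e.fst ∈ S) (hj : e.snd ∉ S) :
    (exceedanceLaw μ m).map (fun x => (S.indicator x, x e.snd)) =
      (((exceedanceLaw μ m).map (fun x => S.indicator x)).prod (edgeLaw T ν e)).map
        (fun p => (p.1, p.1 e.fst * p.2)) := by
  have := h.isProbabilityMeasure_exceedanceLaw m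
  have hpe := isProbabilityMeasure_edgeLaw hν e
  have mS := measurable_indicator_pi S
  have mp : Measurable fun x : V → ℝ => (S.indicator x, x e.snd) :=
    mS.prodMk (measurable_pi_apply _)
  have mφ : Measurable fun p : (V → ℝ) × ℝ => (p.1, p.1 e.fst * p.2) := by fun_prop
  have hind : ∀ x : V → ℝ, S.indicator x e.fst = x e.fst := fun x => Set.indicator_of_mem hi x
  refine Measure.ext_prod fun {B F} hB hF => ?_
  have hκ : Measurable fun x : V → ℝ => edgeLaw T ν e {u | x e.fst * u ∈ F} :=
    (measurable_measure_mul_mem hF).comp (measurable_pi_apply e.fst)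
  have mF : MeasurableSet {x : V → ℝ | x e.snd ∈ F} := measurable_pi_apply _ hF
  have e1 := DFunLike.congr_fun (h.map_indicator_edge hT hG hν hS hi hj hF) B
  rw [Measure.map_apply mS hB, Measure.map_apply mS hB, withDensity_apply _ (mS hB),
    Measure.restrict_apply (mS hB)] at e1
  rw [Measure.map_apply mp (hB.prod hF), Measure.map_apply mφ (hB.prod hF),
    Measure.prod_apply (mφ (hB.prod hF))]
  have hin : ∀ z : V → ℝ, edgeLaw T ν e (Prod.mk z ⁻¹'
      ((fun p : (V → ℝ) × ℝ => (p.1, p.1 e.fst * p.2)) ⁻¹' B ×ˢ F)) =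
      B.indicator (fun z => edgeLaw T ν e {u | z e.fst * u ∈ F}) z := by
    intro z
    by_cases hz : z ∈ B
    · rw [Set.indicator_of_mem hz]
      congr 1
      ext u
      simp [hz]
    · rw [Set.indicator_of_notMem hz]
      convert measure_empty (μ := edgeLaw T ν e)
      ext u
      simp [hz]
  simp_rw [hin]
  rw [lintegral_indicator hB, setLIntegral_map hB hκ mS]
  simp_rw [hind]
  rw [exceedanceLaw, ProbabilityTheory.cond, Measure.restrict_smul, lintegral_smul_measure,
    Measure.smul_apply, ← e1]
  rfl

/-- Both laws have a standard Pareto root, and both grow along an outward edge by multiplying the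
parent's value by an independent weight of the same law. -/
theorem exceedanceLaw_eq_treeMeasure [Fintype T.Dart] (h : IsMultivariatePareto μ)
    (hT : T.IsTree) (hG : IsExtremalGraphicalModel T μ)
    (hν : ∀ i, IsExtremalFunction μ i (ν i)) (m : V) :
    exceedanceLaw μ m = treeMeasure hT m stdPareto (edgeLaw T ν) := by
  classical
  have hpe := isProbabilityMeasure_edgeLaw (T := T) hν
  suffices H : (exceedanceLaw μ m).map (fun x => Set.univ.indicator x) =
      (treeMeasure hT m stdPareto (edgeLaw T ν)).map (fun x => Set.univ.indicator x) by
    simpa only [Set.indicator_univ, Measure.map_id'] using H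
  refine rootedSubtree_induction hT (m := m) (motive := fun S =>
    (exceedanceLaw μ m).map (fun x => S.indicator x) =
      (treeMeasure hT m stdPareto (edgeLaw T ν)).map (fun x => S.indicator x)) ?_ ?_
  · have e1 : (fun x : V → ℝ => ({m} : Set V).indicator x) =
        (fun r : ℝ => Pi.single m r) ∘ fun x => x m := by
      funext x v
      by_cases hv : v = m
      · subst hv; simp
      · simp [hv]
    have ms : Measurable fun r : ℝ => (Pi.single m r : V → ℝ) :=
      measurable_update_apply measurable_const m measurable_id
    have me : Measurable fun x : V → ℝ => x m := measurable_pi_apply m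
    rw [e1, ← Measure.map_map ms me, ← Measure.map_map ms me,
      (hν m).map_eval, treeMeasure, Measure.map_map me (by fun_prop),
      show (fun x : V → ℝ => x m) ∘ treeVec hT m = Prod.fst by funext q; simp,
      Measure.map_fst_prod, measure_univ, one_smul]
  · intro S hS e he hi hj ih
    have mS := measurable_indicator_pi S
    have mup : Measurable fun p : (V → ℝ) × ℝ => Function.update p.1 e.snd p.2 :=
      measurable_update_apply measurable_fst _ measurable_snd
    have mφ : Measurable fun p : (V → ℝ) × ℝ => (p.1, p.1 e.fst * p.2) := by fun_prop
    have mp : Measurable fun x : V → ℝ => (S.indicator x, x e.snd) :=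
      mS.prodMk (measurable_pi_apply _)
    have e1 : (fun x : V → ℝ => (insert e.snd S).indicator x) =
        (fun p : (V → ℝ) × ℝ => Function.update p.1 e.snd p.2) ∘
          fun x => (S.indicator x, x e.snd) := by
      funext x
      rw [indicator_eq_update (Set.mem_insert _ _), Set.insert_sdiff_self_of_notMem hj]
      rfl
    rw [e1, ← Measure.map_map mup mp, ← Measure.map_map mup mp,
      h.map_indicator_prodMk hT hG hν hS hi hj, ih]
    congr 1
    have mX := measurable_indicator_treeVec hT m S
    have law := map_prodMk_eval_of_update (ρ := stdPareto) (ν := edgeLaw T ν) e mX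
      fun r w u => hS.indicator_treeVec_update hT hj subset_rfl r u w
    have mX' : Measurable fun q : ℝ × (T.Dart → ℝ) => (S.indicator (treeVec hT m q), q.2 e) :=
      mX.prodMk (by fun_prop)
    rw [treeMeasure, Measure.map_map mS (by fun_prop), Measure.map_map mp (by fun_prop),
      show (fun x : V → ℝ => S.indicator x) ∘ treeVec hT m =
        fun q => S.indicator (treeVec hT m q) from rfl, ← law, Measure.map_map mφ mX']
    congr 1
    funext q
    simp only [Function.comp_apply, Set.indicator_of_mem hi, treeVec_snd hT he]

end Representation

/-! ### From random variables to tree measures. -/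

section Variables

variable {V : Type*} [Fintype V] {T : SimpleGraph V} [Fintype T.Dart] (hT : T.IsTree)

open Classical in
/-- Extension by zero of weights on the outward edges. -/
noncomputable def extendOutward (m : V) (w : outwardEdges T m → ℝ) (d : T.Dart) : ℝ :=
  if hd : d ∈ outwardEdges T m then w ⟨d, hd⟩ else 0

theorem measurable_extendOutward (m : V) : Measurable (extendOutward (T := T) m) := by
  rw [measurable_pi_iff]
  intro d
  unfold extendOutward
  split_ifs <;> fun_prop

theorem hasLaw_pathProduct {ν : T.Dart → Measure ℝ} [∀ e, IsProbabilityMeasure (ν e)] (m : V)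
    {Ω : Type*} [MeasurableSpace Ω] {Q : Measure Ω} [IsProbabilityMeasure Q] {P : Ω → ℝ}
    {W : T.Dart → Ω → ℝ} (hP : HasLaw P stdPareto Q)
    (hW : ∀ e ∈ outwardEdges T m, HasLaw (W e) (ν e) Q)
    (hI : iIndepFun (fun e : outwardEdges T m => W e) Q)
    (hPI : IndepFun P (fun ω (e : outwardEdges T m) => W e ω) Q) :
    HasLaw (fun ω i => P ω * pathProduct hT W m ω i) (treeMeasure hT m stdPareto ν) Q := by
  classical
  let Ψ : ℝ × (outwardEdges T m → ℝ) → V → ℝ := fun q => treeVec hT m (q.1, extendOutward m q.2)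
  have hΨ : Measurable Ψ := (measurable_treeVec hT m).comp
    (measurable_fst.prodMk ((measurable_extendOutward m).comp measurable_snd))
  have law : HasLaw (fun ω => (P ω, fun e : outwardEdges T m => W e ω))
      (stdPareto.prod (Measure.pi fun e : outwardEdges T m => ν e)) Q :=
    hPI.hasLaw_prod hP (hI.hasLaw_pi fun e => hW e e.2)
  -- `treeMeasure` draws a weight for every dart, whereas only the outward ones are given; the
  -- surplus weights are integrated out.
  have hres : (Measure.pi ν).map (fun w (e : outwardEdges T m) => w e) =
      Measure.pi fun e : outwardEdges T m => ν e := by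
    have h1 : iIndepFun (fun d (w : T.Dart → ℝ) => w d) (Measure.pi ν) :=
      iIndepFun_pi (X := fun _ => id) fun _ => aemeasurable_id
    have h2 : iIndepFun (fun (e : outwardEdges T m) (w : T.Dart → ℝ) => w e) (Measure.pi ν) :=
      h1.precomp Subtype.val_injective
    rw [h2.map_fun_eq_pi_map fun e => (measurable_pi_apply _).aemeasurable]
    congr 1
    funext e
    exact (measurePreserving_eval ν e.1).map_eq
  have htree : HasLaw Ψ (treeMeasure hT m stdPareto ν)
      (stdPareto.prod (Measure.pi fun e : outwardEdges T m => ν e)) := by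
    refine ⟨hΨ.aemeasurable, ?_⟩
    have hmap : stdPareto.prod (Measure.pi fun e : outwardEdges T m => ν e) =
        (stdPareto.prod (Measure.pi ν)).map
          (Prod.map id fun w (e : outwardEdges T m) => w e) := by
      rw [← Measure.map_prod_map _ _ measurable_id (by fun_prop), hres, Measure.map_id]
    rw [hmap, Measure.map_map hΨ (by fun_prop), treeMeasure]
    congr 1
    funext q
    funext i
    simp only [Function.comp_apply, Ψ, treeVec, Prod.map_fst, Prod.map_snd, id]
    congr 1
    refine edgeProd_congr_outward hT fun d hd => ?_
    simp [extendOutward, hd]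
  refine (htree.comp law).congr (Filter.Eventually.of_forall fun ω => ?_)
  funext i
  simp only [Function.comp_apply, Ψ, treeVec]
  congr 1
  change edgeProd hT m (fun d => W d ω) i = _
  refine edgeProd_congr_outward hT fun d hd => ?_
  simp [extendOutward, hd]

theorem paretoMixture_pathProduct {Ω : Type*} [MeasurableSpace Ω] {Q : Measure Ω}
    [IsProbabilityMeasure Q] {W : T.Dart → Ω → ℝ} (hW : ∀ e, Measurable (W e))
    (hI : iIndepFun W Q) (m : V) :
    paretoMixture (Q.map (pathProduct hT W m)) =
      treeMeasure hT m stdPareto (fun e => Q.map (W e)) := by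
  have hWm : Measurable fun ω e => W e ω := measurable_pi_iff.2 hW
  have hEm : Measurable fun w : T.Dart → ℝ => edgeProd hT m w :=
    measurable_pi_iff.2 fun i => measurable_edgeProd hT m i
  have h1 : Q.map (pathProduct hT W m) =
      (Measure.pi fun e => Q.map (W e)).map (fun w => edgeProd hT m w) := by
    rw [← hI.map_fun_eq_pi_map fun e => (hW e).aemeasurable, Measure.map_map hEm hWm]
    rfl
  have : ∀ e, IsProbabilityMeasure (Q.map (W e)) := fun e =>
    Measure.isProbabilityMeasure_map (hW e).aemeasurable
  have : IsProbabilityMeasure ((Measure.pi fun e => Q.map (W e)).map (fun w => edgeProd hT m w)) :=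
    Measure.isProbabilityMeasure_map hEm.aemeasurable
  have h2 : stdPareto.prod ((Measure.pi fun e => Q.map (W e)).map (fun w => edgeProd hT m w)) =
      (stdPareto.prod (Measure.pi fun e => Q.map (W e))).map
        (Prod.map id fun w => edgeProd hT m w) := by
    rw [← Measure.map_prod_map _ _ measurable_id hEm, Measure.map_id]
  rw [paretoMixture, h1, h2, Measure.map_map (by fun_prop) (by fun_prop), treeMeasure]
  rfl

end Variables

end ExtremalTree

/-! ### The main theorem. -/

open ExtremalTree in
theorem mainTheorem5 {V : Type*} [Fintype V] (T : SimpleGraph V) (hT : T.IsTree) :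
    -- Stochastic representation of an extremal tree model
    (∀ μ : Measure (V → ℝ), IsMultivariatePareto μ → IsExtremalGraphicalModel T μ →
      (∀ i : V, ∃! ν : Measure (V → ℝ), IsExtremalFunction μ i ν) ∧
      ∀ ν : V → Measure (V → ℝ), (∀ i, IsExtremalFunction μ i (ν i)) →
      ∀ (m : V) {Ω : Type*} [MeasurableSpace Ω] (Q : Measure Ω) [IsProbabilityMeasure Q]
        (P : Ω → ℝ) (W : T.Dart → Ω → ℝ),
        HasLaw P stdPareto Q →
        (∀ e ∈ outwardEdges T m, HasLaw (W e) ((ν e.fst).map (fun w => w e.snd)) Q) →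
        iIndepFun (fun e : outwardEdges T m => W e) Q →
        IndepFun P (fun ω (e : outwardEdges T m) => W e ω) Q →
        HasLaw (fun ω i => P ω * pathProduct hT W m ω i) (exceedanceLaw μ m) Q) ∧
    -- Construction of an extremal tree model from its edge variables
    (∀ {Ω : Type*} [MeasurableSpace Ω] (Q : Measure Ω) [IsProbabilityMeasure Q]
      (W : T.Dart → Ω → ℝ),
      (∀ e, Measurable (W e)) → (∀ e, ∀ᵐ ω ∂Q, 0 ≤ W e ω) → iIndepFun W Q →
      (∀ e, BivariateDuality Q (W e) (W e.symm)) →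
      (∀ (m m' : V) (A : Set (V → ℝ)), MeasurableSet A →
        A ⊆ paretoSupportAt m ∩ paretoSupportAt m' →
        paretoMixture (Q.map (pathProduct hT W m)) A =
          paretoMixture (Q.map (pathProduct hT W m')) A) ∧
      ∃ μ : Measure (V → ℝ),
        (IsMultivariatePareto μ ∧
          (∀ m, IsExtremalFunction μ m (Q.map (pathProduct hT W m)))) ∧
        (∀ μ' : Measure (V → ℝ), IsMultivariatePareto μ' →
          (∀ m, IsExtremalFunction μ' m (Q.map (pathProduct hT W m))) → μ' = μ) ∧
        IsExtremalGraphicalModel T μ) := by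
  classical
  have : Fintype T.Dart := Fintype.ofFinite _
  refine ⟨fun μ hμ hG => ⟨hμ.existsUnique_isExtremalFunction, ?_⟩, ?_⟩
  · intro ν hν m Ω _ Q _ P W hP hW hI hPI
    have := isProbabilityMeasure_edgeLaw (T := T) hν
    rw [exceedanceLaw_eq_treeMeasure hμ hT hG hν m]
    exact hasLaw_pathProduct hT m hP hW hI hPI
  · intro Ω _ Q _ W hW hnn hI hdual
    have hprob : ∀ e, IsProbabilityMeasure (Q.map (W e)) := fun e =>
      Measure.isProbabilityMeasure_map (hW e).aemeasurable
    have hν : ∀ e, ∀ᵐ u ∂(Q.map (W e)), 0 ≤ u := fun e =>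
      (ae_map_iff (hW e).aemeasurable measurableSet_Ici).2 (hnn e)
    have hd : ∀ e : T.Dart, LawDuality (Q.map (W e)) (Q.map (W e.symm)) := fun e =>
      (hdual e).lawDuality (hW e) (hW e.symm)
    have hmix := paretoMixture_pathProduct hT hW hI
    obtain ⟨μ, hμ, hex⟩ := exists_multivariatePareto hT hν hd
    have hpm : ∀ m, Measurable (pathProduct hT W m) := fun m =>
      measurable_pi_iff.2 fun i =>
        (measurable_edgeProd hT m i).comp (measurable_pi_iff.2 hW)
    have hE : ∀ m, IsExtremalFunction μ m (Q.map (pathProduct hT W m)) := by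
      intro m
      refine ⟨Measure.isProbabilityMeasure_map (hpm m).aemeasurable, ?_, ?_, ?_⟩
      · refine (ae_map_iff (hpm m).aemeasurable ?_).2 ?_
        · rw [Set.ofPred_forall]
          exact MeasurableSet.iInter fun i => measurableSet_le measurable_const
            (measurable_pi_apply i)
        · filter_upwards [ae_all_iff.2 hnn] with ω hω i
          exact edgeProd_nonneg hT hω m i
      · refine (ae_map_iff (hpm m).aemeasurable
          (measurableSet_eq_fun (measurable_pi_apply m) measurable_const)).2 ?_
        exact Filter.Eventually.of_forall fun ω => edgeProd_self hT m _
      · rw [hex m, hmix m]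
    refine ⟨fun m m' A _ hsub => ?_, μ, ⟨hμ, hE⟩, fun μ' hμ' hE' => ?_,
      isExtremalGraphicalModel_of_exceedanceLaw hT hex⟩
    -- On such `A` each mixture is `μ` divided by the exceedance probability, which is the same for
    -- both roots.
    · have h1 : A ⊆ {x | 1 < x m} := fun x hx => (hsub hx).1.2
      have h2 : A ⊆ {x | 1 < x m'} := fun x hx => (hsub hx).2.2
      rw [hmix, hmix, ← hex, ← hex, exceedanceLaw_apply, exceedanceLaw_apply, hμ.margins m m',
        Set.inter_eq_right.2 h1, Set.inter_eq_right.2 h2]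
    · exact hμ'.eq_of_exceedanceLaw_eq hμ fun m => by
        rw [(hE' m).exceedanceLaw_eq, (hE m).exceedanceLaw_eq]
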